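/- All digraphs may have loops. For a group $K$ and $S\subseteq K$, the Cayley digraph $\mathrm{Cay}(K,S)$ has vertex set $K$ and arcs $(g,gs)$, $g\in K$, $s\in S$; "a Cayley digraph of $K$" means a digraph isomorphic to some $\mathrm{Cay}(K,S)$. A digraph $\Gamma$ is of product type $\Gamma_1,\dots,\Gamma_r$ if, for some identification of $V(\Gamma)$ with $V(\Gamma_1)\times\cdots\times V(\Gamma_r)$, the group $\mathrm{Aut}(\Gamma_1)\times\cdots\times\mathrm{Aut}(\Gamma_r)$, acting coordinatewise, is contained in $\mathrm{Aut}(\Gamma)$. For permutation groups $A$ on $X$ and $B$ on $Y$, $A\wr B$ is the group of all permutations of $X\times Y$ of the form $(x,y)\mapsto(g(x),h_x(y))$ with $g\in A$ and $h_x\in B$ for every $x\in X$. A multiwreath product of cyclic groups is a permutation group that is permutation isomorphic to $C_1\wr C_2\wr\cdots\wr C_m$ for some $m\ge 1$ and cyclic groups $C_1,\dots,C_m$, each in its regular action (the case $m=1$ is allowed). Theorem. Let $n=p_1^{a_1}\cdots p_r^{a_r}$ with $p_1,\dots,p_r$ distinct primes and all $a_i\ge 1$. Let $X$ be a set with $n$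 elements, and let $G$ and $H$ be regular abelian subgroups of $\mathrm{Sym}(X)$ with $G$ cyclic. For each $i$ let $G_{p_i}$ and $H_{p_i}$ be Sylow $p_i$-subgroups of $G$ and $H$ respectively. Let $\Gamma$ be a digraph with vertex set $X$ that is a Cayley digraph of $G$. 1. If $\Gamma$ is of product type $\Gamma_1,\dots,\Gamma_r$ for some digraphs $\Gamma_1,\dots,\Gamma_r$ such that each $\Gamma_i$ is a Cayley digraph of both $G_{p_i}$ and $H_{p_i}$, then $\Gamma$ is a Cayley digraph of $H$. 2. Conversely, suppose that $G,H\le N\le\mathrm{Aut}(\Gamma)$ for some nilpotent group $N$ (so that $\Gamma$ is a Cayley digraph of $H$). Then there are digraphs $\Gamma_1,\dots,\Gamma_r$ such that $\Gamma$ is of product type $\Gamma_1,\dots,\Gamma_r$, each $\Gamma_i$ is a Cayley digraph of both $G_{p_i}$ and $H_{p_i}$, and each $\mathrm{Aut}(\Gamma_i)$ is a multiwreath product of cyclic groups. -/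

import Mathlib

universe u v

/-- A permutation group `K` on `X` is regular: for any two points there is exactly one element
of `K` carrying the first to the second (that is, `K` is transitive and all point stabilizers
are trivial). -/
def IsRegularPermGroup {X : Type u} (K : Subgroup (Equiv.Perm X)) : Prop :=
  ∀ x y : X, ∃! σ : Equiv.Perm X, σ ∈ K ∧ σ x = y

/-- The Cayley digraph `Cay(K, S)`: its vertices are the elements of `K`, and its arcs are the
pairs `(g, g * s)` with `g ∈ K` and `s ∈ S`. -/
def cayleyDigraph (K : Type u) [Group K] (S : Set K) : Digraph K where
  Adj g h := ∃ s ∈ S, h = g * s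

/-- `Γ` is (isomorphic to) a Cayley digraph of the group `K`. -/
def IsCayleyDigraphOf {V : Type u} (Γ : Digraph V) (K : Type v) [Group K] : Prop :=
  ∃ S : Set K, Nonempty (Γ.Adj ≃r (cayleyDigraph K S).Adj)

/-- The automorphism group of a digraph, as a permutation group on its vertices. -/
def digraphAut {V : Type u} (Γ : Digraph V) : Subgroup (Equiv.Perm V) where
  carrier := {σ | ∀ x y, Γ.Adj (σ x) (σ y) ↔ Γ.Adj x y}
  mul_mem' := by
    intro σ τ hσ hτ x y
    exact (hσ (τ x) (τ y)).trans (hτ x y)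
  one_mem' := fun _ _ => Iff.rfl
  inv_mem' := by
    intro σ hσ x y
    have h := hσ (σ⁻¹ x) (σ⁻¹ y)
    simpa using h.symm

/-- `Γ` is of product type `Δ 1, …, Δ r`: the direct product of the permutation groups
`Aut (Δ i)`, acting coordinatewise on the product of the vertex sets, is contained in `Aut Γ`,
for some identification of the vertices of `Γ` with the elements of that product. -/
def IsOfProductType {X : Type u} {r : ℕ} {V : Fin r → Type v}
    (Γ : Digraph X) (Δ : ∀ i, Digraph (V i)) : Prop :=
  ∃ e : (∀ i, V i) ≃ X, ∀ σ : ∀ i, Equiv.Perm (V i), (∀ i, σ i ∈ digraphAut (Δ i)) →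
    e.permCongr (Equiv.piCongrRight σ) ∈ digraphAut Γ

/-- The wreath product `G ≀ H` of permutation groups: all permutations of `X × Y` of the form
`(x, y) ↦ (g x, h_x y)` with `g ∈ G` and `h_x ∈ H` for each `x`. -/
def permWreath {X : Type u} {Y : Type v} (G : Subgroup (Equiv.Perm X))
    (H : Subgroup (Equiv.Perm Y)) : Subgroup (Equiv.Perm (X × Y)) where
  carrier := {π | ∃ g ∈ G, ∃ h : X → Equiv.Perm Y, (∀ x, h x ∈ H) ∧
    ∀ x y, π (x, y) = (g x, h x y)}
  mul_mem' := by
    rintro π ρ ⟨g, hg, h, hh, hπ⟩ ⟨g', hg', h', hh', hρ⟩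
    refine ⟨g * g', G.mul_mem hg hg', fun x => h (g' x) * h' x,
      fun x => H.mul_mem (hh _) (hh' _), fun x y => ?_⟩
    simp [Equiv.Perm.mul_apply, hρ, hπ]
  one_mem' := ⟨1, G.one_mem, fun _ => 1, fun _ => H.one_mem, fun _ _ => rfl⟩
  inv_mem' := by
    rintro π ⟨g, hg, h, hh, hπ⟩
    refine ⟨g⁻¹, G.inv_mem hg, fun x => (h (g⁻¹ x))⁻¹, fun x => H.inv_mem (hh _), fun x y => ?_⟩
    rw [Equiv.Perm.inv_eq_iff_eq, hπ]
    simp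

/-- A permutation group is a multiwreath product of cyclic groups: up to relabelling the points,
it is `C₁ ≀ C₂ ≀ ⋯ ≀ Cₘ` for some `m ≥ 1` and cyclic groups `C₁, …, Cₘ` in their regular
actions. The case `m = 1` is the trivial multiwreath product. -/
inductive IsMultiwreathOfCyclic : ∀ {X : Type u}, Subgroup (Equiv.Perm X) → Prop
  | cyclic {X : Type u} (C : Subgroup (Equiv.Perm X)) :
      IsCyclic C → IsRegularPermGroup C → IsMultiwreathOfCyclic C
  | wreath {X Y : Type u} (C : Subgroup (Equiv.Perm X)) (K : Subgroup (Equiv.Perm Y)) :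
      IsCyclic C → IsRegularPermGroup C → IsMultiwreathOfCyclic K →
      IsMultiwreathOfCyclic (permWreath C K)
  | relabel {X Y : Type u} (e : X ≃ Y) (K : Subgroup (Equiv.Perm X)) :
      IsMultiwreathOfCyclic K → IsMultiwreathOfCyclic (K.map e.permCongrHom.toMonoidHom)

universe w

/-! For item 1, each `Aut (Δ i)` contains the left translations of `H_{p_i}`. Acting coordinatewise,
these give a regular copy of the product of the Sylow subgroups of `H` inside `Aut Γ`, and that
product is `H`.

For item 2, `G` identifies `X` with the product of the rings `ZMod (p i ^ a i)`. In the nilpotent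
group `N`, elements of coprime prime-power orders commute, so those of `p i`-power order act on the
`i`-th coordinate alone (`exists_coordHom_eq`). This leaves, for each prime, a `p`-group `P` on
`ZMod (p ^ K)` containing all translations and a regular abelian group `H`.

Such a `P` preserves congruence modulo every `p ^ l` and commutes with the shift by `p ^ l` modulo
`p ^ (l + 1)` (`IsPGroup.respectsFiltration`). Call `l` a wreath level if point stabilizers are
transitive on every other class modulo `p ^ l`. For consecutive wreath levels `l < m`, put a
directed cycle of length `p ^ (m - l)` over the digraph built for level `m`. The resulting digraph
has an iterated wreath product of cyclic groups as automorphism group, and each automorphism agrees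
on any two given points with an element of `P`. This suffices, because preserving `Γ` is a condition
on pairs of points.

That the digraph is also Cayley for `H` requires the section of `H` between consecutive levels to be
cyclic. A non-cyclic section would contain an element of order `p` lying too high in the filtration,
and commutators with it produce a further wreath level strictly in between
(`RespectsFiltration.exists_stabilizer_move`). -/

/-! ### Cycles over complemented digraphs and their automorphism groups. -/

/-- The lexicographic product of the directed cycle generated by `c` in `C` with the complement
of `Δ`. -/
def cycleWreath {C : Type u} {Y : Type v} [Add C] (c : C) (Δ : Digraph Y) : Digraph (C × Y) where
  Adj s t := t.1 = s.1 + c ∨ (t.1 = s.1 ∧ ¬ Δ.Adj s.2 t.2)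

/-- A digraph without sinks in which any two vertices are joined by an undirected walk. -/
structure Digraph.IsLinked {Y : Type v} (Δ : Digraph Y) : Prop where
  exists_adj : ∀ y, ∃ z, Δ.Adj y z
  connected : ∀ R : Y → Y → Prop, Equivalence R → (∀ y z, Δ.Adj y z → R y z) → ∀ y z, R y z

/-- The regular permutation group of translations of an additive group. -/
def translations (C : Type u) [AddCommGroup C] : Subgroup (Equiv.Perm C) :=
  (MulAction.toPermHom (Multiplicative C) C).range

theorem mem_translations {C : Type u} [AddCommGroup C] {σ : Equiv.Perm C} :
    σ ∈ translations C ↔ ∃ a, ∀ x, σ x = a + x := by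
  constructor
  · rintro ⟨a, rfl⟩
    exact ⟨a.toAdd, fun x => rfl⟩
  · rintro ⟨a, ha⟩
    exact ⟨Multiplicative.ofAdd a, Equiv.ext fun x => (ha x).symm⟩

theorem translations_isCyclic (C : Type u) [AddCommGroup C] [IsAddCyclic C] :
    IsCyclic (translations C) :=
  isCyclic_of_surjective (MulAction.toPermHom (Multiplicative C) C).rangeRestrict
    (MonoidHom.rangeRestrict_surjective _)

theorem translations_isRegular (C : Type u) [AddCommGroup C] :
    IsRegularPermGroup (translations C) := by
  intro x y
  refine ⟨Equiv.addLeft (y - x), ⟨mem_translations.2 ⟨y - x, fun z => rfl⟩, by simp⟩, ?_⟩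
  rintro σ ⟨hσ, hxy⟩
  obtain ⟨a, ha⟩ := mem_translations.1 hσ
  ext z
  rw [ha] at hxy
  simp [ha, ← hxy]

theorem cycleWreath_isLinked {C : Type u} {Y : Type v} [AddCommGroup C] {c : C}
    (hc : ∀ a : C, ∃ n : ℕ, n • c = a) (Δ : Digraph Y) : (cycleWreath c Δ).IsLinked where
  exists_adj s := ⟨(s.1 + c, s.2), Or.inl rfl⟩
  connected R hR hadj := by
    have h1 : ∀ a y z, R (a, y) (a + c, z) := fun a y z => hadj _ _ (Or.inl rfl)
    have h2 : ∀ a y z, R (a, y) (a, z) := fun a y z =>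
      hR.trans (h1 a y z) (hR.symm (h1 a z z))
    have h3 : ∀ (n : ℕ) a y z, R (a, y) (a + n • c, z) := by
      intro n
      induction n with
      | zero => intro a y z; simpa using h2 a y z
      | succ n ih =>
        intro a y z
        rw [succ_nsmul, ← add_assoc]
        exact hR.trans (ih a y z) (h1 _ z z)
    rintro ⟨a, y⟩ ⟨b, z⟩
    obtain ⟨n, hn⟩ := hc (b - a)
    have := h3 n a y z
    rwa [hn, add_sub_cancel] at this

/-- If the cycle has length two, all arcs between distinct fibres are present, so non-arcs stay
inside fibres; thanks to the complement, the arcs of `Δ` are non-arcs, and they connect each fibre.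
For longer cycles, counting common out-neighbours separates the two cases: vertices of one fibre
share the whole next fibre, vertices of distinct fibres share fewer than `Nat.card Y`. -/
theorem cycleWreath_aut_fst_eq {C : Type u} {Y : Type v} [AddCommGroup C] [Finite C] [Finite Y]
    {c : C} (hc0 : c ≠ 0) (hc : ∀ a : C, ∃ n : ℕ, n • c = a) {Δ : Digraph Y} (hΔ : Δ.IsLinked)
    {σ : Equiv.Perm (C × Y)} (hσ : σ ∈ digraphAut (cycleWreath c Δ)) (a : C) (y z : Y) :
    (σ (a, y)).1 = (σ (a, z)).1 := by
  have hne : ∀ b : C, b ≠ b + c := fun b hb => hc0 (by simpa using hb)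
  by_cases h2 : c + c = 0
  · have hcc : ∀ s t : C × Y, s.1 ≠ t.1 → (cycleWreath c Δ).Adj s t := by
      intro s t hst
      refine Or.inl ?_
      obtain ⟨n, hn⟩ := hc (t.1 - s.1)
      rcases Nat.even_or_odd' n with ⟨k, rfl | rfl⟩
      · rw [mul_comm, mul_nsmul, two_nsmul, ← nsmul_add, h2, nsmul_zero] at hn
        exact absurd (sub_eq_zero.1 hn.symm).symm hst
      · rw [add_nsmul, mul_comm, mul_nsmul, two_nsmul, ← nsmul_add, h2, nsmul_zero, zero_add,
          one_nsmul] at hn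
        rw [hn]; abel
    refine hΔ.connected (fun y z => (σ (a, y)).1 = (σ (a, z)).1)
      ⟨fun _ => rfl, fun h => h.symm, fun h h' => h.trans h'⟩ (fun y z hyz => ?_) y z
    by_contra hcon
    have h3 := (hσ (a, y) (a, z)).1 (hcc _ _ hcon)
    rcases h3 with h3 | h3
    · exact hne _ h3
    · exact h3.2 hyz
  · let Nb : C × Y → Set (C × Y) := fun s => {t | (cycleWreath c Δ).Adj s t}
    have hNb : ∀ s t, (Nb (σ s) ∩ Nb (σ t)).ncard = (Nb s ∩ Nb t).ncard := by
      intro s t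
      rw [← Set.ncard_image_of_injective (Nb s ∩ Nb t) σ.injective]
      congr 1
      ext w
      constructor
      · rintro ⟨h1, h2⟩
        refine ⟨σ.symm w, ⟨?_, ?_⟩, by simp⟩
        · exact (hσ _ _).1 (by simpa [Nb] using h1)
        · exact (hσ _ _).1 (by simpa [Nb] using h2)
      · rintro ⟨w, ⟨h1, h2⟩, rfl⟩
        exact ⟨(hσ _ _).2 h1, (hσ _ _).2 h2⟩
    have hbig : Nat.card Y ≤ (Nb (a, y) ∩ Nb (a, z)).ncard := by
      have : (Set.range fun w : Y => (a + c, w)) ⊆ Nb (a, y) ∩ Nb (a, z) := by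
        rintro _ ⟨w, rfl⟩
        exact ⟨Or.inl rfl, Or.inl rfl⟩
      refine le_trans ?_ (Set.ncard_le_ncard this (Set.toFinite _))
      rw [← Set.image_univ, Set.ncard_image_of_injective _ (Prod.mk_right_injective _),
        Set.ncard_univ]
    have hless : ∀ (b : C) (y : Y) (A : Set (C × Y)),
        (∀ w ∈ A, w.1 = b ∧ ¬ Δ.Adj y w.2) → A.ncard < Nat.card Y := by
      intro b y A hA
      obtain ⟨z, hz⟩ := hΔ.exists_adj y
      have h1 : A ⊆ Prod.mk b '' {z}ᶜ := by
        intro w hw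
        refine ⟨w.2, ?_, by rw [← (hA w hw).1]⟩
        rintro h
        exact (hA w hw).2 (by rwa [Set.mem_singleton_iff.1 h])
      refine lt_of_le_of_lt (Set.ncard_le_ncard h1 (Set.toFinite _)) ?_
      rw [Set.ncard_image_of_injective _ (Prod.mk_right_injective _), ← Set.ncard_univ Y]
      exact Set.ncard_lt_ncard (Set.ssubset_univ_iff.2 (by simp)) (Set.toFinite _)
    have hsmall : ∀ s t : C × Y, s.1 ≠ t.1 → (Nb s ∩ Nb t).ncard < Nat.card Y := by
      intro s t hst
      -- Since `c + c ≠ 0`, the common out-neighbours lie in just one of the two fibres, and there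
      -- the absence of sinks in `Δ` excludes at least one vertex.
      by_cases h : s.1 = t.1 + c
      · refine hless s.1 s.2 _ ?_
        rintro w ⟨h1 | h1, h3 | h3⟩
        · exact absurd (add_right_cancel (h1.symm.trans h3)) hst
        · rw [h3.1, h, add_assoc] at h1
          exact absurd (by simpa using h1) h2
        · exact h1
        · exact absurd (h1.1.symm.trans h3.1) hst
      · refine hless t.1 t.2 _ ?_
        rintro w ⟨h1 | h1, h3 | h3⟩
        · exact absurd (add_right_cancel (h1.symm.trans h3)) hst
        · exact h3
        · exact absurd (h1.1.symm.trans h3) h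
        · exact absurd (h1.1.symm.trans h3.1) hst
    by_contra hcon
    have := hsmall _ _ hcon
    rw [hNb] at this
    omega

theorem digraphAut_cycleWreath {C : Type u} {Y : Type v} [AddCommGroup C] [Finite C] [Finite Y]
    {c : C} (hc0 : c ≠ 0) (hc : ∀ a : C, ∃ n : ℕ, n • c = a) {Δ : Digraph Y} (hΔ : Δ.IsLinked)
    [Nonempty Y] :
    digraphAut (cycleWreath c Δ) = permWreath (translations C) (digraphAut Δ) := by
  have hne : ∀ b : C, b ≠ b + c := fun b hb => hc0 (by simpa using hb)
  ext σ
  constructor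
  · intro hσ
    obtain ⟨y0⟩ := ‹Nonempty Y›
    have hfst := cycleWreath_aut_fst_eq hc0 hc hΔ hσ
    have hfst' := cycleWreath_aut_fst_eq hc0 hc hΔ (inv_mem hσ)
    have hstep : ∀ a, (σ (a + c, y0)).1 = (σ (a, y0)).1 + c := by
      intro a
      have h1 : (cycleWreath c Δ).Adj (σ (a, y0)) (σ (a + c, y0)) := (hσ _ _).2 (Or.inl rfl)
      rcases h1 with h1 | h1
      · exact h1
      -- Images in a common fibre would be pulled back to a common fibre by `σ⁻¹`.
      · have h2 := hfst' (σ (a, y0)).1 (σ (a, y0)).2 (σ (a + c, y0)).2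
        rw [Prod.mk.eta, ← h1.1, Prod.mk.eta] at h2
        simp at h2
        exact absurd h2 hc0
    have htr : ∀ (n : ℕ), (σ (n • c, y0)).1 = (σ (0, y0)).1 + n • c := by
      intro n
      induction n with
      | zero => simp
      | succ n ih => rw [succ_nsmul, hstep, ih, add_assoc]
    have hs : ∀ a y, (σ (a, y)).1 = (σ (0, y0)).1 + a := by
      intro a y
      obtain ⟨n, rfl⟩ := hc a
      rw [hfst _ y y0, htr]
    have hinj : ∀ a, Function.Injective fun y => (σ (a, y)).2 := by
      intro a y z hyz
      have : σ (a, y) = σ (a, z) := Prod.ext (hfst a y z) hyz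
      simpa using σ.injective this
    refine ⟨Equiv.addLeft (σ (0, y0)).1, mem_translations.2 ⟨_, fun x => rfl⟩,
      fun a => Equiv.ofBijective _ (Finite.injective_iff_bijective.1 (hinj a)), fun a y z => ?_,
      fun a y => Prod.ext (hs a y) rfl⟩
    have h1 := hσ (a, y) (a, z)
    have h2 : ∀ t t' : C × Y, t'.1 = t.1 → ((cycleWreath c Δ).Adj t t' ↔ ¬ Δ.Adj t.2 t'.2) := by
      intro t t' ht
      simp [cycleWreath, ht, hc0]
    rw [h2 _ _ (hfst a z y), h2 (a, y) (a, z) rfl] at h1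
    exact not_iff_not.1 h1
  · rintro ⟨g, hg, h, hh, hπ⟩ ⟨a, y⟩ ⟨b, z⟩
    obtain ⟨d, hd⟩ := mem_translations.1 hg
    rw [hπ, hπ]
    by_cases hab : b = a
    · subst hab
      have := hh b y z
      simp [cycleWreath, this, hc0]
    · simp [cycleWreath, hd, hab, add_assoc]

theorem cycleWreath_isMultiwreath {C Y : Type u} [AddCommGroup C] [IsAddCyclic C] [Finite C]
    [Finite Y] [Nonempty Y] {c : C} (hc0 : c ≠ 0) (hc : ∀ a : C, ∃ n : ℕ, n • c = a)
    {Δ : Digraph Y} (hΔ : Δ.IsLinked) (hmw : IsMultiwreathOfCyclic (digraphAut Δ)) :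
    IsMultiwreathOfCyclic (digraphAut (cycleWreath c Δ)) := by
  rw [digraphAut_cycleWreath hc0 hc hΔ]
  exact .wreath _ _ (translations_isCyclic C) (translations_isRegular C) hmw

/-! ### Cayley digraphs and group extensions. -/

theorem isCayleyDigraphOf_iff {V : Type u} {Γ : Digraph V} {K : Type v} [Group K] :
    IsCayleyDigraphOf Γ K ↔
      ∃ (S : Set K) (f : V ≃ K), ∀ x y, Γ.Adj x y ↔ (f x)⁻¹ * f y ∈ S := by
  constructor
  · rintro ⟨S, ⟨f⟩⟩
    refine ⟨S, f.toEquiv, fun x y => ?_⟩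
    rw [← f.map_rel_iff]
    constructor
    · rintro ⟨s, hs, h⟩
      change f y = f x * s at h
      change (f x)⁻¹ * f y ∈ S
      rw [h]; simpa using hs
    · intro h
      exact ⟨_, h, by simp⟩
  · rintro ⟨S, f, hf⟩
    refine ⟨S, ⟨f, fun {x y} => ?_⟩⟩
    rw [hf]
    constructor
    · rintro ⟨s, hs, h⟩
      rw [h]; simpa using hs
    · intro h
      exact ⟨_, h, by simp⟩

theorem IsCayleyDigraphOf.congr {V : Type u} {Γ : Digraph V} {K : Type v} [Group K] {K' : Type w}
    [Group K'] (h : IsCayleyDigraphOf Γ K) (e : K ≃* K') : IsCayleyDigraphOf Γ K' := by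
  rw [isCayleyDigraphOf_iff] at h ⊢
  obtain ⟨S, f, hf⟩ := h
  refine ⟨e.symm ⁻¹' S, f.trans e.toEquiv, fun x y => ?_⟩
  simp [hf]

/-- A surjective homomorphism splits its domain as a set into image and kernel. -/
theorem exists_equiv_prod_ker {K : Type u} [Group K] {C : Type v} [Group C] (φ : K →* C)
    (hφ : Function.Surjective φ) :
    ∃ ε : K ≃ C × φ.ker, (∀ k, (ε k).1 = φ k) ∧
      (∀ k k', φ k = φ k' → (((ε k).2)⁻¹ * (ε k').2 : K) = k⁻¹ * k') := by
  obtain ⟨s, hs⟩ := hφ.hasRightInverse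
  refine ⟨⟨fun k => (φ k, ⟨(s (φ k))⁻¹ * k, by simp [MonoidHom.mem_ker, hs (φ k)]⟩),
    fun q => s q.1 * q.2, fun k => by simp, ?_⟩, fun k => rfl, fun k k' h => ?_⟩
  · rintro ⟨q, b, hb⟩
    rw [MonoidHom.mem_ker] at hb
    have : φ (s q * b) = q := by rw [map_mul, hb, hs q, mul_one]
    simp [this]
  · simp [h]

/-- The connection set is the fibre of `φ` over `c` together with the complement of `S` in the
kernel. The splitting of `K` preserves quotients within each coset of the kernel, which is all that
the second part needs. -/
theorem isCayleyDigraphOf_cycleWreath {C : Type u} {Y : Type v} [AddCommGroup C] {c : C}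
    {Δ : Digraph Y} {K : Type w} [Group K] (φ : K →* Multiplicative C)
    (hφ : Function.Surjective φ) (h : IsCayleyDigraphOf Δ φ.ker) :
    IsCayleyDigraphOf (cycleWreath c Δ) K := by
  rw [isCayleyDigraphOf_iff] at h ⊢
  obtain ⟨S, f, hf⟩ := h
  obtain ⟨ε, hε1, hε2⟩ := exists_equiv_prod_ker φ hφ
  refine ⟨{k | φ k = Multiplicative.ofAdd c} ∪ {k | ∃ hk : k ∈ φ.ker, ⟨k, hk⟩ ∉ S},
    ((Multiplicative.ofAdd (α := C)).prodCongr f).trans ε.symm, ?_⟩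
  rintro ⟨a, y⟩ ⟨b, z⟩
  obtain ⟨k, hk⟩ := ε.surjective (Multiplicative.ofAdd a, f y)
  obtain ⟨k', hk'⟩ := ε.surjective (Multiplicative.ofAdd b, f z)
  have e1 : (((Multiplicative.ofAdd (α := C)).prodCongr f).trans ε.symm) (a, y) = k := by
    simp [← hk]
  have e2 : (((Multiplicative.ofAdd (α := C)).prodCongr f).trans ε.symm) (b, z) = k' := by
    simp [← hk']
  rw [e1, e2]
  have hφk : φ k = Multiplicative.ofAdd a := by rw [← hε1, hk]
  have hφk' : φ k' = Multiplicative.ofAdd b := by rw [← hε1, hk']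
  have h1 : φ (k⁻¹ * k') = Multiplicative.ofAdd (b - a) := by
    rw [map_mul, map_inv, hφk, hφk', ← ofAdd_neg, ← ofAdd_add]; congr 1; abel
  have hcross : φ (k⁻¹ * k') = Multiplicative.ofAdd c ↔ b = a + c := by
    rw [h1, Multiplicative.ofAdd.injective.eq_iff, sub_eq_iff_eq_add']
  have hker : k⁻¹ * k' ∈ φ.ker ↔ b = a := by
    rw [MonoidHom.mem_ker, h1, ← ofAdd_zero, Multiplicative.ofAdd.injective.eq_iff, sub_eq_zero]
  refine or_congr hcross.symm ?_
  constructor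
  · rintro ⟨hab, hyz⟩
    refine ⟨hker.2 hab, ?_⟩
    have h2 := hε2 k k' (by rw [hφk, hφk']; exact congrArg _ hab.symm)
    rw [hk, hk'] at h2
    have h3 : (⟨k⁻¹ * k', hker.2 hab⟩ : φ.ker) = (f y)⁻¹ * f z := Subtype.ext h2.symm
    rwa [h3, ← hf]
  · rintro ⟨hk0, hS⟩
    have hab := hker.1 hk0
    refine ⟨hab, ?_⟩
    have h2 := hε2 k k' (by rw [hφk, hφk']; exact congrArg _ hab.symm)
    rw [hk, hk'] at h2
    have h3 : (⟨k⁻¹ * k', hk0⟩ : φ.ker) = (f y)⁻¹ * f z := Subtype.ext h2.symm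
    rwa [h3, ← hf] at hS

/-! ### Arithmetic modulo powers of `p`. -/

/-- Congruence modulo `p ^ l` in the ring `ZMod (p ^ K)`. -/
def ModPow {p K : ℕ} (l : ℕ) (x y : ZMod (p ^ K)) : Prop := (p : ZMod (p ^ K)) ^ l ∣ y - x

namespace ModPow

variable {p K : ℕ} {l m : ℕ} {x y z x' y' : ZMod (p ^ K)}

theorem refl (l : ℕ) (x : ZMod (p ^ K)) : ModPow l x x := by simp [ModPow]

theorem symm (h : ModPow l x y) : ModPow l y x := by
  unfold ModPow at *; rw [← neg_sub]; exact h.neg_right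

theorem trans (h : ModPow l x y) (h' : ModPow l y z) : ModPow l x z := by
  unfold ModPow at *; simpa using dvd_add h h'

theorem mono (hlm : l ≤ m) (h : ModPow m x y) : ModPow l x y :=
  (pow_dvd_pow _ hlm).trans h

theorem add (h : ModPow l x y) (h' : ModPow l x' y') : ModPow l (x + x') (y + y') := by
  unfold ModPow at *
  have := dvd_add h h'
  rwa [show y + y' - (x + x') = y - x + (y' - x') by ring]

theorem add_right (h : ModPow l x y) (z : ZMod (p ^ K)) : ModPow l (x + z) (y + z) :=
  h.add (refl l z)

theorem exists_eq (h : ModPow l x y) : ∃ c, y = x + (p : ZMod (p ^ K)) ^ l * c := by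
  obtain ⟨c, hc⟩ := h
  exact ⟨c, by rw [← hc]; ring⟩

theorem add_mul (l : ℕ) (x c : ZMod (p ^ K)) : ModPow l x (x + (p : ZMod (p ^ K)) ^ l * c) :=
  ⟨c, by ring⟩

theorem zero (x y : ZMod (p ^ K)) : ModPow 0 x y := by simp [ModPow]

theorem top_iff : ModPow K x y ↔ x = y := by
  have : (p : ZMod (p ^ K)) ^ K = 0 := by
    rw [← Nat.cast_pow]; exact ZMod.natCast_self _
  rw [ModPow, this, zero_dvd_iff, sub_eq_zero, eq_comm]

end ModPow

section arith

variable {p K : ℕ} [hp : Fact p.Prime]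

theorem exists_natCast_eq (x : ZMod (p ^ K)) : ∃ n : ℕ, (n : ZMod (p ^ K)) = x :=
  ⟨x.val, by simp⟩

theorem pow_dvd_natCast_iff {l : ℕ} (hl : l ≤ K) (n : ℕ) :
    (p : ZMod (p ^ K)) ^ l ∣ n ↔ p ^ l ∣ n := by
  constructor
  · rintro ⟨c, hc⟩
    obtain ⟨c, rfl⟩ := exists_natCast_eq c
    rw [← Nat.cast_pow, ← Nat.cast_mul, ZMod.natCast_eq_natCast_iff] at hc
    have h1 : n ≡ p ^ l * c [MOD p ^ l] := hc.of_dvd (pow_dvd_pow p hl)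
    exact (Nat.modEq_zero_iff_dvd.1 (h1.trans (by simp [Nat.ModEq])))
  · rintro ⟨c, rfl⟩
    exact ⟨c, by push_cast; ring⟩

theorem dvd_of_pow_succ_dvd_mul {m : ℕ} (hm : m < K) {z : ZMod (p ^ K)}
    (h : (p : ZMod (p ^ K)) ^ (m + 1) ∣ (p : ZMod (p ^ K)) ^ m * z) : (p : ZMod (p ^ K)) ∣ z := by
  obtain ⟨n, rfl⟩ := exists_natCast_eq z
  have h1 : p ^ (m + 1) ∣ p ^ m * n := by
    rw [← pow_dvd_natCast_iff (K := K) hm]; push_cast; exact h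
  rw [pow_succ] at h1
  have h2 := Nat.dvd_of_mul_dvd_mul_left (pow_pos hp.out.pos m) h1
  exact Nat.cast_dvd_cast h2

/-- Write `z` as `p ^ e * n'` with `e ≤ l` and `n'` prime to `p`; the multiplier is `p ^ (l - e)`
times an inverse of `n'` modulo `p`. -/
theorem exists_natCast_mul_modPow {l : ℕ} (hl : l < K) {z : ZMod (p ^ K)}
    (hz : ¬ (p : ZMod (p ^ K)) ^ (l + 1) ∣ z) :
    ∃ m : ℕ, ModPow (l + 1) ((p : ZMod (p ^ K)) ^ l) (m * z) := by
  obtain ⟨n, rfl⟩ := exists_natCast_eq z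
  rw [pow_dvd_natCast_iff hl] at hz
  have hn0 : n ≠ 0 := by rintro rfl; simp at hz
  obtain ⟨e, n', hn', rfl⟩ := Nat.exists_eq_pow_mul_and_not_dvd hn0 p hp.out.ne_one
  have hel : e ≤ l := by
    by_contra h
    exact hz ((pow_dvd_pow p (by omega)).trans (dvd_mul_right _ _))
  have hcop : Nat.Coprime n' p := ((Nat.Prime.coprime_iff_not_dvd hp.out).2 hn').symm
  obtain ⟨u, -, hu⟩ := Nat.exists_mul_mod_eq_one_of_coprime hcop hp.out.one_lt
  refine ⟨p ^ (l - e) * u, ?_⟩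
  have h1 := Nat.div_add_mod (n' * u) p
  rw [hu] at h1
  refine ⟨((n' * u / p : ℕ) : ZMod (p ^ K)), ?_⟩
  have h2 : (n' * u : ZMod (p ^ K)) = p * ((n' * u / p : ℕ) : ZMod (p ^ K)) + 1 := by
    rw [← Nat.cast_mul, ← h1]; push_cast
    rw [h1]
  have h3 : (p : ZMod (p ^ K)) ^ (l - e) * (p : ZMod (p ^ K)) ^ e = (p : ZMod (p ^ K)) ^ l := by
    rw [← pow_add]; congr 1; omega
  push_cast
  calc _ = ((p : ZMod (p ^ K)) ^ (l - e) * (p : ZMod (p ^ K)) ^ e) * (n' * u)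
        - (p : ZMod (p ^ K)) ^ l := by ring
    _ = _ := by rw [h3, h2]; ring

/-- Some multiple of `z` is `p ^ l * (1 + p * e)`, and the second factor is a unit because `p` is
nilpotent. -/
theorem dvd_pow_of_not_pow_succ_dvd {l : ℕ} (hl : l < K) {z : ZMod (p ^ K)}
    (hz : ¬ (p : ZMod (p ^ K)) ^ (l + 1) ∣ z) : z ∣ (p : ZMod (p ^ K)) ^ l := by
  obtain ⟨m, e, he⟩ := exists_natCast_mul_modPow hl hz
  have hnil : IsNilpotent ((p : ZMod (p ^ K)) * -e) :=
    Commute.isNilpotent_mul_right (Commute.all _ _)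
      ⟨K, by rw [← Nat.cast_pow]; exact ZMod.natCast_self _⟩
  obtain ⟨w, hw⟩ := hnil.isUnit_one_sub.exists_right_inv
  refine ⟨m * w, ?_⟩
  calc (p : ZMod (p ^ K)) ^ l = (p : ZMod (p ^ K)) ^ l * ((1 - p * -e) * w) := by
        rw [hw, mul_one]
    _ = ((p : ZMod (p ^ K)) ^ l + (p : ZMod (p ^ K)) ^ (l + 1) * e) * w := by ring
    _ = z * (m * w) := by rw [← he]; ring

end arith

/-! ### Permutation `p`-groups containing the translations respect the filtration. -/

/-- The permutations of `ZMod (p ^ K)` that are trivial modulo `p ^ l`. -/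
def modKernel (p K l : ℕ) : Subgroup (Equiv.Perm (ZMod (p ^ K))) where
  carrier := {π | ∀ x, ModPow l x (π x)}
  mul_mem' := fun {π ρ} hπ hρ x => (hρ x).trans (hπ (ρ x))
  one_mem' := fun x => ModPow.refl l x
  inv_mem' := fun {π} hπ x => by
    have := (hπ (π⁻¹ x)).symm
    simpa using this

/-- A permutation group on `ZMod (p ^ K)` that preserves congruence modulo every power of `p` and
commutes with translation by `p ^ l` modulo `p ^ (l + 1)`. -/
structure RespectsFiltration {p K : ℕ} (P : Subgroup (Equiv.Perm (ZMod (p ^ K)))) : Prop where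
  modPow : ∀ l, ∀ π ∈ P, ∀ x y, ModPow l x y → ModPow l (π x) (π y)
  shift : ∀ l, ∀ π ∈ P, ∀ x,
    ModPow (l + 1) (π (x + (p : ZMod (p ^ K)) ^ l)) (π x + (p : ZMod (p ^ K)) ^ l)

section pgroup

variable {p K : ℕ} [hp : Fact p.Prime] {P : Subgroup (Equiv.Perm (ZMod (p ^ K)))}

theorem addRight_mem (h1 : Equiv.addRight (1 : ZMod (p ^ K)) ∈ P) (d : ZMod (p ^ K)) :
    Equiv.addRight d ∈ P := by
  obtain ⟨n, rfl⟩ := exists_natCast_eq d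
  induction n with
  | zero =>
    convert P.one_mem
    ext x; simp
  | succ n ih =>
    convert P.mul_mem h1 ih using 1
    ext x; simp [add_assoc]

/-- Modulo `p ^ (l + 1)` the group acts as a nontrivial `p`-group, so it has a nontrivial central
element. Commuting with all translations, this element is itself a translation modulo `p ^ (l + 1)`,
and one of its powers is the shift by `p ^ l`. -/
theorem shift_of_modPow_succ (hP : IsPGroup p P) (h1 : Equiv.addRight (1 : ZMod (p ^ K)) ∈ P)
    {l : ℕ} (hl : l < K)
    (hB : ∀ π ∈ P, ∀ x y, ModPow (l + 1) x y → ModPow (l + 1) (π x) (π y)) :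
    ∀ π ∈ P, ∀ x,
      ModPow (l + 1) (π (x + (p : ZMod (p ^ K)) ^ l)) (π x + (p : ZMod (p ^ K)) ^ l) := by
  let W : Subgroup P := (modKernel p K (l + 1)).subgroupOf P
  have hW : ∀ π : P, π ∈ W ↔ ∀ x, ModPow (l + 1) x (π.1 x) := fun π => Iff.rfl
  have hWn : W.Normal := by
    refine ⟨fun w hw π => ?_⟩
    rw [hW] at hw ⊢
    intro x
    have := hB π π.2 _ _ (hw (π.1⁻¹ x))
    simpa using this
  have hnt : Nontrivial (P ⧸ W) := by
    rw [QuotientGroup.nontrivial_iff]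
    intro htop
    have h2 : (⟨_, h1⟩ : P) ∈ W := by rw [htop]; trivial
    rw [hW] at h2
    have h3 := h2 0
    have h4 : (p : ZMod (p ^ K)) ^ (l + 1) ∣ ((1 : ℕ) : ZMod (p ^ K)) := by
      simpa [ModPow] using h3
    rw [pow_dvd_natCast_iff hl, Nat.dvd_one, Nat.pow_eq_one] at h4
    rcases h4 with h4 | h4
    · exact hp.out.ne_one h4
    · omega
  have hcn := (hP.to_quotient W).center_nontrivial
  obtain ⟨⟨c', hc'⟩, hcne⟩ := exists_ne (1 : Subgroup.center (P ⧸ W))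
  obtain ⟨c, rfl⟩ := QuotientGroup.mk_surjective c'
  have hcW : c ∉ W := fun h => hcne (Subtype.ext ((QuotientGroup.eq_one_iff c).2 h))
  have hcomm : ∀ π ∈ P, ∀ x, ModPow (l + 1) (π (c.1 x)) (c.1 (π x)) := by
    intro π hπ x
    have h2 := Subgroup.mem_center_iff.1 hc' ((⟨π, hπ⟩ : P) : P ⧸ W)
    rw [← QuotientGroup.mk_mul, ← QuotientGroup.mk_mul, QuotientGroup.eq] at h2
    rw [hW] at h2
    have h3 := hB (π * c) (P.mul_mem hπ c.2) _ _ (h2 x)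
    simpa using h3
  set c0 := c.1 0 with hc0
  have hcx : ∀ x, ModPow (l + 1) (c.1 x) (x + c0) := by
    intro x
    have := hcomm _ (addRight_mem h1 x) 0
    simpa [add_comm] using this.symm
  have hc0n : ¬ (p : ZMod (p ^ K)) ^ (l + 1) ∣ c0 := by
    intro h
    refine hcW ((hW c).2 fun x => ?_)
    refine ModPow.trans ?_ (hcx x).symm
    simpa [ModPow] using h
  obtain ⟨m, hm⟩ := exists_natCast_mul_modPow hl hc0n
  have hpow : ∀ (n : ℕ) x, ModPow (l + 1) ((c.1 ^ n) x) (x + n * c0) := by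
    intro n
    induction n with
    | zero => intro x; simpa using ModPow.refl _ _
    | succ n ih =>
      intro x
      rw [pow_succ']
      refine (hcx ((c.1 ^ n) x)).trans ?_
      have := (ih x).add_right c0
      push_cast
      rwa [add_assoc, ← add_one_mul] at this
  have hcommpow : ∀ (n : ℕ), ∀ π ∈ P, ∀ x, ModPow (l + 1) (π ((c.1 ^ n) x)) ((c.1 ^ n) (π x)) := by
    intro n π hπ
    induction n with
    | zero => intro x; simpa using ModPow.refl _ _
    | succ n ih =>
      intro x
      rw [pow_succ']
      exact (hcomm π hπ _).trans (hB c.1 c.2 _ _ (ih x))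
  intro π hπ x
  have h5 : ∀ y, ModPow (l + 1) ((c.1 ^ m) y) (y + (p : ZMod (p ^ K)) ^ l) := fun y =>
    (hpow m y).trans ((ModPow.refl _ y).add hm.symm)
  exact (hB π hπ _ _ (h5 x).symm).trans ((hcommpow m π hπ x).trans (h5 _))

theorem IsPGroup.respectsFiltration (hP : IsPGroup p P)
    (h1 : Equiv.addRight (1 : ZMod (p ^ K)) ∈ P) : RespectsFiltration P := by
  have htop : ∀ l, K ≤ l → (p : ZMod (p ^ K)) ^ l = 0 := by
    intro l hl
    have : (p : ZMod (p ^ K)) ^ K = 0 := by rw [← Nat.cast_pow]; exact ZMod.natCast_self _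
    rw [show l = K + (l - K) by omega, pow_add, this, zero_mul]
  -- Descending induction on `l`: commuting with the shift by `p ^ l` modulo `p ^ (l + 1)` forces
  -- classes modulo `p ^ l`, the orbits of that shift, to be preserved.
  have hB : ∀ d l, l + d = K → ∀ π ∈ P, ∀ x y, ModPow l x y → ModPow l (π x) (π y) := by
    intro d
    induction d with
    | zero =>
      intro l hl π hπ x y hxy
      obtain rfl : l = K := hl
      rw [ModPow.top_iff] at hxy ⊢
      rw [hxy]
    | succ d ih =>
      intro l hl π hπ x y hxy
      have hZ := shift_of_modPow_succ hP h1 (l := l) (by omega) (ih (l + 1) (by omega)) π hπ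
      obtain ⟨c, rfl⟩ := hxy.exists_eq
      obtain ⟨n, rfl⟩ := exists_natCast_eq c
      clear hxy
      induction n with
      | zero => simpa using ModPow.refl _ _
      | succ n ihn =>
        push_cast
        rw [mul_add, mul_one, ← add_assoc]
        refine ihn.trans (ModPow.trans ?_ ((hZ _).mono (Nat.le_succ l)).symm)
        simpa using ModPow.add_mul l _ (1 : ZMod (p ^ K))
  refine ⟨fun l π hπ x y hxy => ?_, fun l π hπ x => ?_⟩
  · rcases le_or_gt l K with hl | hl
    · exact hB (K - l) l (by omega) π hπ x y hxy
    · obtain rfl : x = y := ModPow.top_iff.1 (hxy.mono hl.le)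
      exact ModPow.refl _ _
  · rcases lt_or_ge l K with hl | hl
    · exact shift_of_modPow_succ hP h1 hl (hB (K - (l + 1)) _ (by omega)) π hπ x
    · simpa [htop l hl] using ModPow.refl _ _

end pgroup

theorem ModPow.iterate_shift {p K n : ℕ} [Fact p.Prime] {f : ZMod (p ^ K) → ZMod (p ^ K)}
    {d : ZMod (p ^ K)} (hf : ∀ x, ModPow n (f (x + d)) (f x + d)) (x c : ZMod (p ^ K)) :
    ModPow n (f (x + d * c)) (f x + d * c) := by
  obtain ⟨k, rfl⟩ := exists_natCast_eq c
  induction k with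
  | zero => simpa using ModPow.refl _ _
  | succ k ih =>
    push_cast
    rw [mul_add, mul_one, ← add_assoc, ← add_assoc]
    exact (hf _).trans (ih.add_right d)

/-! ### Regular abelian subgroups and the movement of point stabilizers. -/

namespace RespectsFiltration

theorem shift_of_commute {p K : ℕ} {P : Subgroup (Equiv.Perm (ZMod (p ^ K)))}
    (hP : RespectsFiltration P) {n : ℕ} {c r : Equiv.Perm (ZMod (p ^ K))}
    {d : ZMod (p ^ K)} (hc : c ∈ P)
    (hcr : ∀ x, ModPow n (c (r x)) (r (c x)))
    (hs : ∀ x, ModPow n (r (c (x + d))) (c (r x + d))) (x : ZMod (p ^ K)) :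
    ModPow n (r (x + d)) (r x + d) := by
  have h := (hcr (x + d)).trans (hs x)
  have := hP.modPow n c⁻¹ (P.inv_mem hc) _ _ h
  simpa using this

variable {p K : ℕ} [hp : Fact p.Prime] {P H : Subgroup (Equiv.Perm (ZMod (p ^ K)))}

theorem shift_of_modPow (hP : RespectsFiltration P) {l : ℕ} {π : Equiv.Perm (ZMod (p ^ K))}
    (hπ : π ∈ P) {x y : ZMod (p ^ K)} (h : ModPow l x y) :
    ModPow (l + 1) (π y) (π x + (y - x)) := by
  obtain ⟨c, rfl⟩ := h.exists_eq
  rw [add_sub_cancel_left]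
  exact ModPow.iterate_shift (hP.shift l π hπ) x c

/-- The displacement by `r` is a multiple of `p ^ i`, with which `f` commutes; the displacement by
`f` is a multiple of `p ^ (m + 1)`, with which all of `P` commutes modulo `p ^ (m + 2)`. -/
theorem commute_of_shift (hP : RespectsFiltration P) {i m : ℕ}
    {f r : Equiv.Perm (ZMod (p ^ K))} (hf : f ∈ modKernel p K (m + 1))
    (hfi : ∀ x, ModPow (m + 2) (f (x + (p : ZMod (p ^ K)) ^ i)) (f x + (p : ZMod (p ^ K)) ^ i))
    (hr : r ∈ P) (hri : r ∈ modKernel p K i) (x : ZMod (p ^ K)) :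
    ModPow (m + 2) (f (r x)) (r (f x)) := by
  obtain ⟨b, hb⟩ := (hri x).exists_eq
  have h1 := ModPow.iterate_shift hfi x b
  have h2 := hP.shift_of_modPow hr (hf x)
  rw [← hb] at h1
  refine h1.trans ?_
  rw [show f x + (p : ZMod (p ^ K)) ^ i * b = r x + (f x - x) by rw [hb]; ring]
  exact h2.symm

/-- For `k ∈ H` with `k 0 = x`, commutativity gives `h x = k (h 0)`, so the shift property of `k`
controls `h`. -/
theorem regular_shift (hP : RespectsFiltration P) (hHP : H ≤ P)
    (hHt : ∀ x, ∃ h ∈ H, h 0 = x) (hHc : ∀ h ∈ H, ∀ k ∈ H, h * k = k * h) {l : ℕ}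
    {h : Equiv.Perm (ZMod (p ^ K))} (hh : h ∈ H) (hl : ModPow l 0 (h 0)) (x : ZMod (p ^ K)) :
    ModPow (l + 1) (h x) (x + h 0) := by
  obtain ⟨k, hk, rfl⟩ := hHt x
  have h1 := hP.shift_of_modPow (hHP hk) hl
  rw [sub_zero] at h1
  have h2 : h (k 0) = k (h 0) := congrArg (fun σ : Equiv.Perm _ => σ 0) (hHc h hh k hk)
  rwa [h2]

theorem regular_mem_modKernel (hP : RespectsFiltration P) (hHP : H ≤ P)
    (hHt : ∀ x, ∃ h ∈ H, h 0 = x) (hHc : ∀ h ∈ H, ∀ k ∈ H, h * k = k * h) {l : ℕ}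
    {h : Equiv.Perm (ZMod (p ^ K))} (hh : h ∈ H) (hl : ModPow l 0 (h 0)) :
    h ∈ modKernel p K l := by
  intro x
  have h1 := ((hP.regular_shift hHP hHt hHc hh hl x).mono (Nat.le_succ l)).symm
  refine ModPow.trans ?_ h1
  simpa using (ModPow.refl l x).add hl

/-- The elements of `R` that commute with translation by `p ^ m` modulo `p ^ n`. -/
def shiftCentralizer (hP : RespectsFiltration P) {R : Subgroup (Equiv.Perm (ZMod (p ^ K)))}
    (hR : R ≤ P) (m n : ℕ) : Subgroup (Equiv.Perm (ZMod (p ^ K))) where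
  carrier := {r | r ∈ R ∧
    ∀ x, ModPow n (r (x + (p : ZMod (p ^ K)) ^ m)) (r x + (p : ZMod (p ^ K)) ^ m)}
  mul_mem' := by
    rintro r s ⟨hr, hr'⟩ ⟨hs, hs'⟩
    exact ⟨R.mul_mem hr hs, fun x => (hP.modPow n r (hR hr) _ _ (hs' x)).trans (hr' (s x))⟩
  one_mem' := ⟨R.one_mem, fun x => ModPow.refl _ _⟩
  inv_mem' := by
    rintro r ⟨hr, hr'⟩
    refine ⟨R.inv_mem hr, fun x => ?_⟩
    have := hP.modPow n r⁻¹ (R.inv_mem hr |> fun h => hR h) _ _ (hr' (r⁻¹ x))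
    simpa using this.symm

/-- The witness is `τ` preceded by translation by `-τ 0`. If it commuted with the shift, so would
`τ`, whence `(τ ^ p) 0` would be `p * τ 0` modulo `p ^ (i + 2)`, which is nonzero there. -/
theorem exists_not_shift_base (hP : RespectsFiltration P) (hHP : H ≤ P)
    (hHt : ∀ x, ∃ h ∈ H, h 0 = x) (hHc : ∀ h ∈ H, ∀ k ∈ H, h * k = k * h) {i : ℕ}
    (hi : i + 2 ≤ K) {τ : Equiv.Perm (ZMod (p ^ K))} (hτ : τ ∈ H) (hτi : ModPow i 0 (τ 0))
    (hτi' : ¬ ModPow (i + 1) 0 (τ 0)) (hτp : ModPow (i + 2) 0 ((τ ^ p) 0))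
    {R : Subgroup (Equiv.Perm (ZMod (p ^ K)))} (hτR : τ ∈ R)
    (hRi : ∀ c, Equiv.addRight ((p : ZMod (p ^ K)) ^ i * c) ∈ R) :
    ∃ f ∈ R, f ∈ modKernel p K (i + 1) ∧ ∃ x,
      ¬ ModPow (i + 2) (f (x + (p : ZMod (p ^ K)) ^ i)) (f x + (p : ZMod (p ^ K)) ^ i) := by
  obtain ⟨a, ha⟩ := hτi.exists_eq
  rw [zero_add] at ha
  have hf : ∀ x, (τ * Equiv.addRight ((p : ZMod (p ^ K)) ^ i * (-a))) x = τ (x - τ 0) := by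
    intro x; rw [ha]; simp [sub_eq_add_neg]
  refine ⟨τ * Equiv.addRight ((p : ZMod (p ^ K)) ^ i * (-a)), R.mul_mem hτR (hRi _), ?_, ?_⟩
  · intro x
    rw [hf]
    have := hP.regular_shift hHP hHt hHc hτ hτi (x - τ 0)
    rw [sub_add_cancel] at this
    exact this.symm
  · by_contra! hcon
    have h1 : ∀ x, ModPow (i + 2) (τ (x + (p : ZMod (p ^ K)) ^ i)) (τ x + (p : ZMod (p ^ K)) ^ i) := by
      intro x
      have := hcon (x + τ 0)
      rw [hf, hf] at this
      rwa [show x + τ 0 + (p : ZMod (p ^ K)) ^ i - τ 0 = x + (p : ZMod (p ^ K)) ^ i by ring,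
        add_sub_cancel_right] at this
    have h2 : ∀ n : ℕ, ModPow (i + 2) ((τ ^ n) 0) ((p : ZMod (p ^ K)) ^ i * (n * a)) := by
      intro n
      induction n with
      | zero => simpa using ModPow.refl _ _
      | succ n ih =>
        have h3 := hP.modPow _ τ (hHP hτ) _ _ ih
        have h4 := ModPow.iterate_shift h1 0 (n * a)
        rw [zero_add] at h4
        rw [pow_succ']
        refine h3.trans (h4.trans ?_)
        rw [ha]; push_cast
        rw [show (p : ZMod (p ^ K)) ^ i * ((n + 1) * a) =
          (p : ZMod (p ^ K)) ^ i * a + (p : ZMod (p ^ K)) ^ i * (n * a) by ring]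
        exact ModPow.refl _ _
    have h3 := hτp.trans (h2 p)
    have h4 : (p : ZMod (p ^ K)) ^ (i + 1 + 1) ∣ (p : ZMod (p ^ K)) ^ (i + 1) * a := by
      have : (p : ZMod (p ^ K)) ^ i * (p * a) = (p : ZMod (p ^ K)) ^ (i + 1) * a := by ring
      rw [← this]; simpa [ModPow] using h3
    obtain ⟨b, hb⟩ := dvd_of_pow_succ_dvd_mul (by omega) h4
    refine hτi' ?_
    rw [ha, hb]
    exact ⟨b, by ring⟩

/-- Otherwise all of `R` commutes modulo `p ^ (m + 2)` with its elements trivial modulo `p ^ (m +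
1)`. Then the subgroup `R'` of `R` commuting with the shift by `p ^ m` again satisfies the
hypotheses on `R`, which is why `ih` ranges over all such subgroups. It yields some `u`, and `u ^ p`
fails to commute one level deeper. -/
theorem exists_not_shift_succ (hP : RespectsFiltration P) (hHP : H ≤ P)
    (hHt : ∀ x, ∃ h ∈ H, h 0 = x) (hHc : ∀ h ∈ H, ∀ k ∈ H, h * k = k * h) {i m : ℕ}
    (him : i ≤ m) (hm : m + 1 < K)
    (ih : ∀ R ≤ P, (∀ π ∈ P, ∀ r ∈ R, π * r * π⁻¹ ∈ R) → R ≤ modKernel p K i →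
      (∀ c, Equiv.addRight ((p : ZMod (p ^ K)) ^ i * c) ∈ R) →
      (∀ h ∈ H, ModPow i 0 (h 0) → h ∈ R) →
      ∃ f ∈ R, f ∈ modKernel p K m ∧ ∃ x,
        ¬ ModPow (m + 1) (f (x + (p : ZMod (p ^ K)) ^ i)) (f x + (p : ZMod (p ^ K)) ^ i))
    {R : Subgroup (Equiv.Perm (ZMod (p ^ K)))} (hR : R ≤ P)
    (hRn : ∀ π ∈ P, ∀ r ∈ R, π * r * π⁻¹ ∈ R) (hRk : R ≤ modKernel p K i)
    (hRi : ∀ c, Equiv.addRight ((p : ZMod (p ^ K)) ^ i * c) ∈ R)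
    (hRH : ∀ h ∈ H, ModPow i 0 (h 0) → h ∈ R) :
    ∃ f ∈ R, f ∈ modKernel p K (m + 1) ∧ ∃ x,
      ¬ ModPow (m + 2) (f (x + (p : ZMod (p ^ K)) ^ i)) (f x + (p : ZMod (p ^ K)) ^ i) := by
  by_contra! hN
  have hcomm : ∀ c ∈ R, c ∈ modKernel p K (m + 1) → ∀ r ∈ R, ∀ x,
      ModPow (m + 2) (c (r x)) (r (c x)) := fun c hc hcm r hr =>
    hP.commute_of_shift hcm (hN c hc hcm) (hR hr) (hRk hr)
  set t : Equiv.Perm (ZMod (p ^ K)) := Equiv.addRight ((p : ZMod (p ^ K)) ^ m) with ht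
  have htR : t ∈ R := by
    have := hRi ((p : ZMod (p ^ K)) ^ (m - i))
    rwa [← pow_add, Nat.add_sub_cancel' him] at this
  have htx : ∀ x, t x = x + (p : ZMod (p ^ K)) ^ m := fun x => rfl
  have htx' : ∀ x, t⁻¹ x = x - (p : ZMod (p ^ K)) ^ m := fun x => by
    rw [Equiv.Perm.inv_eq_iff_eq, htx, sub_add_cancel]
  let R' := hP.shiftCentralizer hR m (m + 2)
  have hex : ∃ u ∈ R', u ∈ modKernel p K m ∧ ∃ x,
      ¬ ModPow (m + 1) (u (x + (p : ZMod (p ^ K)) ^ i)) (u x + (p : ZMod (p ^ K)) ^ i) := by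
    refine ih R' (fun r hr => hR hr.1) ?_ (fun r hr => hRk hr.1) ?_ ?_
    · rintro π hπ r ⟨hr, hr'⟩
      refine ⟨hRn π hπ r hr, ?_⟩
      -- Conjugation by `π` changes `t` only by this commutator, which commutes with `R` modulo `p ^
      -- (m + 2)`.
      have hc : π * t * π⁻¹ * t⁻¹ ∈ R := R.mul_mem (hRn π hπ t htR) (R.inv_mem htR)
      have hcm : π * t * π⁻¹ * t⁻¹ ∈ modKernel p K (m + 1) := by
        intro y
        have h2 := hP.shift m π hπ (π⁻¹ (y - (p : ZMod (p ^ K)) ^ m))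
        rw [show π (π⁻¹ (y - (p : ZMod (p ^ K)) ^ m)) = y - (p : ZMod (p ^ K)) ^ m by simp,
          sub_add_cancel] at h2
        have h3 : (π * t * π⁻¹ * t⁻¹) y =
          π (π⁻¹ (y - (p : ZMod (p ^ K)) ^ m) + (p : ZMod (p ^ K)) ^ m) := by
          simp only [Equiv.Perm.mul_apply, htx', htx]
        rw [h3]; exact h2.symm
      refine hP.shift_of_commute (hR hc) (hcomm _ hc hcm _ (hRn π hπ r hr)) fun y => ?_
      have h2 := hP.modPow _ π hπ _ _ (hr' (π⁻¹ y))
      have h4 : ∀ z, (π * t * π⁻¹ * t⁻¹) (z + (p : ZMod (p ^ K)) ^ m) =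
          π (π⁻¹ z + (p : ZMod (p ^ K)) ^ m) := by
        intro z
        simp only [Equiv.Perm.mul_apply, htx', htx, add_sub_cancel_right]
      rw [h4, h4]
      have h5 : ∀ z, (π * r * π⁻¹) (π z) = π (r z) := fun z => by simp
      rw [h5]
      simpa using h2
    · intro c
      refine ⟨hRi c, fun y => ?_⟩
      simp only [Equiv.coe_addRight]
      rw [add_right_comm]
      exact ModPow.refl _ _
    · intro h hh hhi
      refine ⟨hRH h hh hhi, ?_⟩
      -- The element `k` of `H` imitates `t`: it commutes with `h`, and `k * t⁻¹` commutes with `R`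
      -- modulo `p ^ (m + 2)`.
      obtain ⟨k, hk, hk0⟩ := hHt ((p : ZMod (p ^ K)) ^ m)
      have hkm : ModPow m 0 (k 0) := by rw [hk0]; simp [ModPow]
      have hkR : k ∈ R := hRH k hk (hkm.mono him)
      have hc : k * t⁻¹ ∈ R := R.mul_mem hkR (R.inv_mem htR)
      have hcx : ∀ y, (k * t⁻¹) (y + (p : ZMod (p ^ K)) ^ m) = k y := by
        intro y
        simp only [Equiv.Perm.mul_apply, htx', add_sub_cancel_right]
      have hcm : k * t⁻¹ ∈ modKernel p K (m + 1) := by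
        intro y
        have h2 := hP.regular_shift hHP hHt hHc hk hkm (y - (p : ZMod (p ^ K)) ^ m)
        rw [hk0, sub_add_cancel, ← hcx, sub_add_cancel] at h2
        exact h2.symm
      refine hP.shift_of_commute (hR hc) (hcomm _ hc hcm _ (hRH h hh hhi)) fun y => ?_
      rw [hcx, hcx]
      have h2 : h (k y) = k (h y) := congrArg (fun σ : Equiv.Perm _ => σ y) (hHc h hh k hk)
      rw [h2]; exact ModPow.refl _ _
  obtain ⟨u, ⟨huR, hu⟩, hum, x, hx⟩ := hex
  have hupow : ∀ (n : ℕ) (x a : ZMod (p ^ K)), u x = x + (p : ZMod (p ^ K)) ^ m * a →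
      ModPow (m + 2) ((u ^ n) x) (x + (p : ZMod (p ^ K)) ^ m * (n * a)) := by
    intro n x a ha
    induction n with
    | zero => simpa using ModPow.refl _ _
    | succ n ihn =>
      rw [pow_succ']
      refine (hP.modPow _ u (hR huR) _ _ ihn).trans
        ((ModPow.iterate_shift hu x (n * a)).trans ?_)
      rw [ha]; push_cast
      rw [show x + (p : ZMod (p ^ K)) ^ m * ((n + 1) * a) = x + (p : ZMod (p ^ K)) ^ m * a +
        (p : ZMod (p ^ K)) ^ m * (n * a) by ring]
      exact ModPow.refl _ _
  have hpp : ∀ a : ZMod (p ^ K), (p : ZMod (p ^ K)) ^ m * (p * a) =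
    (p : ZMod (p ^ K)) ^ (m + 1) * a := fun a => by ring
  have hupm : u ^ p ∈ modKernel p K (m + 1) := by
    intro y
    obtain ⟨a, ha⟩ := (hum y).exists_eq
    have := hupow p y a ha
    rw [hpp] at this
    exact (ModPow.add_mul (m + 1) y a).trans (this.mono (by omega)).symm
  have h2 := hN (u ^ p) (R.pow_mem huR p) hupm x
  obtain ⟨a, ha⟩ := (hum x).exists_eq
  obtain ⟨b, hb⟩ := (hum (x + (p : ZMod (p ^ K)) ^ i)).exists_eq
  have h3 := (hupow p _ b hb).symm.trans (h2.trans ((hupow p x a ha).add_right _))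
  rw [hpp, hpp] at h3
  have h4 : (p : ZMod (p ^ K)) ^ (m + 1 + 1) ∣ (p : ZMod (p ^ K)) ^ (m + 1) * (a - b) := by
    unfold ModPow at h3
    convert h3 using 1
    ring
  obtain ⟨e, he⟩ := dvd_of_pow_succ_dvd_mul hm h4
  refine hx ⟨e, ?_⟩
  rw [ha, hb, pow_succ, mul_assoc, ← he]
  ring

theorem exists_not_shift (hP : RespectsFiltration P)
    (h1 : Equiv.addRight (1 : ZMod (p ^ K)) ∈ P) (hHP : H ≤ P)
    (hHt : ∀ x, ∃ h ∈ H, h 0 = x) (hHc : ∀ h ∈ H, ∀ k ∈ H, h * k = k * h) {i L : ℕ}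
    (hi : i + 2 ≤ L) (hL : L ≤ K) {τ : Equiv.Perm (ZMod (p ^ K))} (hτ : τ ∈ H)
    (hτi : ModPow i 0 (τ 0)) (hτi' : ¬ ModPow (i + 1) 0 (τ 0)) (hτp : ModPow L 0 ((τ ^ p) 0))
    {m : ℕ} (him : i < m) (hmL : m < L) :
    ∃ f ∈ P, f ∈ modKernel p K m ∧ ∃ x,
      ¬ ModPow (m + 1) (f (x + (p : ZMod (p ^ K)) ^ i)) (f x + (p : ZMod (p ^ K)) ^ i) := by
  have key : ∀ m, i + 1 ≤ m → m < L → ∀ R ≤ P, (∀ π ∈ P, ∀ r ∈ R, π * r * π⁻¹ ∈ R) →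
      R ≤ modKernel p K i → (∀ c, Equiv.addRight ((p : ZMod (p ^ K)) ^ i * c) ∈ R) →
      (∀ h ∈ H, ModPow i 0 (h 0) → h ∈ R) →
      ∃ f ∈ R, f ∈ modKernel p K m ∧ ∃ x,
        ¬ ModPow (m + 1) (f (x + (p : ZMod (p ^ K)) ^ i)) (f x + (p : ZMod (p ^ K)) ^ i) := by
    intro m him
    induction m, him using Nat.le_induction with
    | base =>
      intro _ R hR hRn hRk hRi hRH
      exact hP.exists_not_shift_base hHP hHt hHc (hi.trans hL) hτ hτi hτi' (hτp.mono hi)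
        (hRH τ hτ hτi) hRi
    | succ m him ih =>
      intro hmL R hR hRn hRk hRi hRH
      exact hP.exists_not_shift_succ hHP hHt hHc (by omega) (by omega) (ih (by omega)) hR hRn
        hRk hRi hRH
  have hex : ∃ f ∈ P ⊓ modKernel p K i, f ∈ modKernel p K m ∧ ∃ x,
      ¬ ModPow (m + 1) (f (x + (p : ZMod (p ^ K)) ^ i)) (f x + (p : ZMod (p ^ K)) ^ i) := by
    refine key m him hmL (P ⊓ modKernel p K i) inf_le_left ?_ inf_le_right ?_ ?_
    · rintro π hπ r ⟨hr, hr'⟩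
      refine ⟨P.mul_mem (P.mul_mem hπ hr) (P.inv_mem hπ), fun x => ?_⟩
      have := hP.modPow i π hπ _ _ (hr' (π⁻¹ x))
      simpa using this
    · intro c
      exact ⟨addRight_mem h1 _, fun x => ModPow.add_mul i x c⟩
    · intro h hh hhi
      exact ⟨hHP hh, hP.regular_mem_modKernel hHP hHt hHc hh hhi⟩
  obtain ⟨f, hf, h⟩ := hex
  exact ⟨f, hf.1, h⟩

/-- If some element of order `p` modulo `p ^ L` of a regular abelian subgroup is not trivial modulo
`p ^ (i + 1)`, then modulo `p ^ L` point stabilizers act transitively on all other blocks of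
congruence modulo `p ^ (i + 1)`. -/
theorem exists_stabilizer_move (hP : RespectsFiltration P)
    (h1 : Equiv.addRight (1 : ZMod (p ^ K)) ∈ P) (hHP : H ≤ P)
    (hHt : ∀ x, ∃ h ∈ H, h 0 = x) (hHc : ∀ h ∈ H, ∀ k ∈ H, h * k = k * h) {i L : ℕ}
    (hi : i + 2 ≤ L) (hL : L ≤ K) {τ : Equiv.Perm (ZMod (p ^ K))} (hτ : τ ∈ H)
    (hτi : ModPow i 0 (τ 0)) (hτi' : ¬ ModPow (i + 1) 0 (τ 0)) (hτp : ModPow L 0 ((τ ^ p) 0))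
    {x y y' : ZMod (p ^ K)} (hxy : ¬ ModPow (i + 1) x y) (hyy : ModPow (i + 1) y y') :
    ∃ π ∈ P, ModPow L (π x) x ∧ ModPow L (π y) y' := by
  have key : ∀ m, i + 1 ≤ m → m ≤ L → ∃ π ∈ P, ModPow m (π x) x ∧ ModPow m (π y) y' := by
    intro m him
    induction m, him using Nat.le_induction with
    | base => exact fun _ => ⟨1, P.one_mem, ModPow.refl _ _, hyy⟩
    | succ m him ih =>
      intro hmL
      obtain ⟨π, hπ, hπx, hπy⟩ := ih (by omega)
      -- Some `f` trivial modulo `p ^ m` displaces `π x` and `π y` differently. If not, conjugation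
      -- by translations makes all such `f` commute with the shift by `π y - π x`, of which `p ^ i`
      -- is a multiple, contradicting `exists_not_shift`.
      have hsep : ∃ f ∈ P, f ∈ modKernel p K m ∧
          ¬ ModPow (m + 1) (f (π x) - π x) (f (π y) - π y) := by
        by_contra! hcon
        have hd : ∀ f ∈ P, f ∈ modKernel p K m → ∀ z,
            ModPow (m + 1) (f (z + (π y - π x))) (f z + (π y - π x)) := by
          intro f hf hfm z
          set s : Equiv.Perm (ZMod (p ^ K)) := Equiv.addRight (z - π x)
          have hsx : ∀ w, s w = w + (z - π x) := fun w => rfl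
          have hsx' : ∀ w, s⁻¹ w = w - (z - π x) := fun w => by
            rw [Equiv.Perm.inv_eq_iff_eq, hsx, sub_add_cancel]
          have hs : s ∈ P := addRight_mem h1 _
          have h2 := hcon (s⁻¹ * f * s) (P.mul_mem (P.mul_mem (P.inv_mem hs) hf) hs) (by
            intro w
            have := hP.modPow m s⁻¹ (P.inv_mem hs) _ _ (hfm (s w))
            simpa using this)
          simp only [Equiv.Perm.mul_apply, hsx, hsx'] at h2
          rw [show π x + (z - π x) = z by ring,
            show π y + (z - π x) = z + (π y - π x) by ring] at h2
          have h3 := (h2.add_right (z + (π y - π x))).symm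
          convert h3 using 1 <;> ring
        have hπxy : ¬ ModPow (i + 1) (π x) (π y) := by
          intro h
          have := hP.modPow _ π⁻¹ (P.inv_mem hπ) _ _ h
          exact hxy (by simpa using this)
        obtain ⟨c, hc⟩ := dvd_pow_of_not_pow_succ_dvd (l := i) (by omega) hπxy
        obtain ⟨f, hf, hfm, z, hz⟩ :=
          hP.exists_not_shift h1 hHP hHt hHc hi hL hτ hτi hτi' hτp him hmL
        have := ModPow.iterate_shift (hd f hf hfm) z c
        rw [← hc] at this
        exact hz this
      obtain ⟨f, hf, hfm, hne⟩ := hsep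
      obtain ⟨a, ha⟩ := (hfm (π x)).exists_eq
      obtain ⟨b, hb⟩ := (hfm (π y)).exists_eq
      obtain ⟨a', ha'⟩ := hπx.exists_eq
      obtain ⟨b', hb'⟩ := hπy.exists_eq
      have hnd : ¬ (p : ZMod (p ^ K)) ^ (0 + 1) ∣ b - a := by
        rintro ⟨e, he⟩
        refine hne ⟨e, ?_⟩
        rw [ha, hb, add_sub_cancel_left, add_sub_cancel_left, ← mul_sub, he]
        ring
      obtain ⟨w, hw⟩ := dvd_pow_of_not_pow_succ_dvd (by omega) hnd
      rw [pow_zero] at hw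
      -- Here `w` inverts `b - a`: `f ^ s` corrects the difference of the two errors, and a
      -- translation then corrects their common part.
      obtain ⟨s, hs⟩ := exists_natCast_eq ((b' - a') * w)
      have hpow : ∀ (n : ℕ) (z e : ZMod (p ^ K)), f z = z + (p : ZMod (p ^ K)) ^ m * e →
          ModPow (m + 1) ((f ^ n) z) (z + (p : ZMod (p ^ K)) ^ m * (n * e)) := by
        intro n z e he
        induction n with
        | zero => simpa using ModPow.refl _ _
        | succ n ihn =>
          rw [pow_succ']
          refine (hP.modPow _ f hf _ _ ihn).trans
            ((ModPow.iterate_shift (hP.shift m f hf) z (n * e)).trans ?_)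
          rw [he]; push_cast
          rw [show z + (p : ZMod (p ^ K)) ^ m * ((n + 1) * e) = z + (p : ZMod (p ^ K)) ^ m * e +
            (p : ZMod (p ^ K)) ^ m * (n * e) by ring]
          exact ModPow.refl _ _
      refine ⟨Equiv.addRight ((p : ZMod (p ^ K)) ^ m * (a' - s * a)) * f ^ s * π,
        P.mul_mem (P.mul_mem (addRight_mem h1 _) (P.pow_mem hf s)) hπ, ?_, ?_⟩
      · refine ((hpow s _ a ha).add_right ((p : ZMod (p ^ K)) ^ m * (a' - s * a))).trans ?_
        rw [show π x + (p : ZMod (p ^ K)) ^ m * (s * a) + (p : ZMod (p ^ K)) ^ m * (a' - s * a) =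
          π x + (p : ZMod (p ^ K)) ^ m * a' by ring, ← ha']
        exact ModPow.refl _ _
      · refine ((hpow s _ b hb).add_right ((p : ZMod (p ^ K)) ^ m * (a' - s * a))).trans ?_
        rw [show π y + (p : ZMod (p ^ K)) ^ m * (s * b) + (p : ZMod (p ^ K)) ^ m * (a' - s * a) =
          π y + (p : ZMod (p ^ K)) ^ m * (s * (b - a) + a') by ring, hs,
          show (b' - a') * w * (b - a) + a' = (b' - a') * ((b - a) * w) + a' by ring, ← hw,
          mul_one, sub_add_cancel, ← hb']
        exact ModPow.refl _ _
  exact key L (by omega) le_rfl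

end RespectsFiltration

/-! ### A cyclicity criterion for abelian `p`-groups. -/

/-- The `p`-th power map lowers the exponent by one, and its nonempty fibres are cosets of the
`p`-torsion. -/
theorem card_pow_prime_pow_eq_one_le {p : ℕ} {Q : Type u} [CommGroup Q] [Finite Q]
    (h : Nat.card {q : Q // q ^ p = 1} ≤ p) (v : ℕ) : Nat.card {q : Q // q ^ p ^ v = 1} ≤ p ^ v := by
  classical
  have := Fintype.ofFinite Q
  simp only [Nat.card_eq_fintype_card, Fintype.card_subtype] at h ⊢
  induction v with
  | zero =>
    refine Finset.card_le_one.2 ?_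
    simp +contextual
  | succ v ih =>
    refine (Finset.card_le_mul_card_image_of_maps_to (f := fun q : Q => q ^ p)
      (t := Finset.univ.filter fun q : Q => q ^ p ^ v = 1) ?_ p ?_).trans ?_
    · intro q hq
      simpa [← pow_mul, ← pow_succ'] using hq
    · intro b _
      by_cases hb : ∃ a : Q, a ^ p = b
      · obtain ⟨a, rfl⟩ := hb
        refine le_trans ?_ h
        refine Finset.card_le_card_of_injOn (fun q => q * a⁻¹) ?_ ?_
        · intro q hq
          have hq' : q ^ p = a ^ p := by simpa using (Finset.mem_filter.1 hq).2
          simp [mul_pow, hq']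
        · intro x _ y _ hxy
          exact mul_right_cancel hxy
      · push Not at hb
        rw [Finset.filter_eq_empty_iff.2 fun q _ => hb q]
        simp
    · rw [pow_succ']
      exact Nat.mul_le_mul_left p ih

theorem IsPGroup.isCyclic_of_card_pow_eq_one_le {p : ℕ} [hp : Fact p.Prime] {Q : Type u}
    [CommGroup Q] [Finite Q] (hQ : IsPGroup p Q) (h : Nat.card {q : Q // q ^ p = 1} ≤ p) :
    IsCyclic Q := by
  classical
  have := Fintype.ofFinite Q
  refine _root_.isCyclic_of_card_pow_eq_one_le fun n hn => ?_
  obtain ⟨v, n', hn', rfl⟩ := Nat.exists_eq_pow_mul_and_not_dvd hn.ne' p hp.out.ne_one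
  have h1 := card_pow_prime_pow_eq_one_le h v
  simp only [Nat.card_eq_fintype_card, Fintype.card_subtype] at h1
  refine le_trans (Finset.card_le_card fun q hq => ?_)
    (h1.trans (Nat.le_mul_of_pos_right _ (Nat.pos_of_ne_zero fun h => hn' (by simp [h]))))
  simp only [Finset.mem_filter, Finset.mem_univ, true_and] at hq ⊢
  obtain ⟨w, hw⟩ := hQ q
  rw [← orderOf_dvd_iff_pow_eq_one] at hq hw ⊢
  have hcop : Nat.Coprime (p ^ w) n' :=
    Nat.Coprime.pow_left _ ((Nat.Prime.coprime_iff_not_dvd hp.out).2 hn')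
  exact (hcop.coprime_dvd_left hw).dvd_of_dvd_mul_right hq

theorem exists_hom_ker_eq_of_isCyclic_quotient {K : Type u} [Group K] [Finite K] (L : Subgroup K)
    [L.Normal] (hcyc : IsCyclic (K ⧸ L)) {C : Type v} [Group C] [IsCyclic C]
    (hcard : Nat.card K = Nat.card C * Nat.card L) :
    ∃ φ : K →* C, Function.Surjective φ ∧ φ.ker = L := by
  have h1 : Nat.card (K ⧸ L) = Nat.card C := by
    rw [Subgroup.card_eq_card_quotient_mul_card_subgroup L] at hcard
    exact Nat.eq_of_mul_eq_mul_right Nat.card_pos hcard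
  let ε := mulEquivOfCyclicCardEq h1
  refine ⟨ε.toMonoidHom.comp (QuotientGroup.mk' L),
    ε.surjective.comp (QuotientGroup.mk'_surjective L), ?_⟩
  ext k
  simp

/-- The `p`-torsion of `K ⧸ L` lies in the image of `M`, which has order `p`; hence the quotient is
cyclic. -/
theorem IsPGroup.exists_hom_ker_eq {p : ℕ} [hp : Fact p.Prime] {K : Type u} [Group K] [Finite K]
    (hcomm : ∀ a b : K, a * b = b * a) (hK : IsPGroup p K) {L M : Subgroup K} (hLM : L ≤ M)
    (hM : ∀ k, k ^ p ∈ L → k ∈ M) (hcardM : Nat.card M = p * Nat.card L) {C : Type v} [Group C]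
    [IsCyclic C] (hcard : Nat.card K = Nat.card C * Nat.card L) :
    ∃ φ : K →* C, Function.Surjective φ ∧ φ.ker = L := by
  let _ : CommGroup K := { ‹Group K› with mul_comm := hcomm }
  refine exists_hom_ker_eq_of_isCyclic_quotient L ?_ hcard
  refine (hK.to_quotient L).isCyclic_of_card_pow_eq_one_le ?_
  have hmap : Nat.card (M.map (QuotientGroup.mk' L)) = p := by
    have h1 := (M.map (QuotientGroup.mk' L)).card_mul_index
    rw [Subgroup.index_map_eq _ (QuotientGroup.mk'_surjective L) (by simpa using hLM)] at h1
    have h2 := M.card_mul_index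
    have h3 := Subgroup.card_eq_card_quotient_mul_card_subgroup L
    rw [← h1, ← h2, hcardM] at h3
    have hi : 0 < M.index := Nat.pos_of_ne_zero M.index_ne_zero_of_finite
    have hL : 0 < Nat.card L := Nat.card_pos
    refine Nat.eq_of_mul_eq_mul_right (Nat.mul_pos hi hL) ?_
    rw [← mul_assoc, ← h3]; ring
  refine le_trans ?_ hmap.le
  refine Nat.card_le_card_of_injective
    (fun q => (⟨q.1, ?_⟩ : M.map (QuotientGroup.mk' L))) fun x y hxy => ?_
  · obtain ⟨q, hq⟩ := q
    obtain ⟨k, rfl⟩ := QuotientGroup.mk_surjective q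
    rw [← QuotientGroup.mk_pow, QuotientGroup.eq_one_iff] at hq
    exact ⟨k, hM k hq, rfl⟩
  · exact Subtype.ext (congrArg (fun z => z.1) hxy)

/-! ### Wreath levels and the construction of the digraph for one prime. -/

/-- The multiples of `p ^ l` in `ZMod (p ^ K)`. -/
abbrev powMultiples (p K l : ℕ) : AddSubgroup (ZMod (p ^ K)) :=
  AddSubgroup.zmultiples ((p : ZMod (p ^ K)) ^ l)

/-- Point stabilizers in `P` act transitively on every other class of congruence modulo `p ^ l`. -/
def IsWreathLevel {p K : ℕ} (P : Subgroup (Equiv.Perm (ZMod (p ^ K)))) (l : ℕ) : Prop :=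
  ∀ x y y', ¬ ModPow l x y → ModPow l y y' → ∃ π ∈ P, π x = x ∧ π y = y'

theorem IsWreathLevel.exists_move {p K : ℕ} {P : Subgroup (Equiv.Perm (ZMod (p ^ K)))} {l : ℕ} (h : IsWreathLevel P l) {x y x' y' : ZMod (p ^ K)}
    (hxy : ¬ ModPow l x y) (hx : ModPow l x x') (hy : ModPow l y y') :
    ∃ π ∈ P, π x = x' ∧ π y = y' := by
  obtain ⟨π, hπ, h1, h2⟩ := h x y y' hxy hy
  obtain ⟨ρ, hρ, h3, h4⟩ := h y' x x' (fun h => hxy (h.symm.trans hy.symm)) hx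
  exact ⟨ρ * π, P.mul_mem hρ hπ, by simp [h1, h4], by simp [h2, h3]⟩

section

variable {p K : ℕ} [hp : Fact p.Prime] {P H : Subgroup (Equiv.Perm (ZMod (p ^ K)))}

theorem mem_powMultiples {l : ℕ} {x : ZMod (p ^ K)} : x ∈ powMultiples p K l ↔ ModPow l 0 x := by
  rw [AddSubgroup.mem_zmultiples_iff]
  constructor
  · rintro ⟨k, rfl⟩
    exact ⟨k, by simp [mul_comm]⟩
  · rintro h
    obtain ⟨c, rfl⟩ := h.exists_eq
    obtain ⟨n, rfl⟩ := exists_natCast_eq c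
    exact ⟨n, by simp [mul_comm]⟩

theorem card_powMultiples {l : ℕ} (hl : l ≤ K) : Nat.card (powMultiples p K l) = p ^ (K - l) := by
  rw [Nat.card_zmultiples, ← Nat.cast_pow, ZMod.addOrderOf_coe _ (NeZero.ne _),
    Nat.gcd_eq_right (pow_dvd_pow p hl), Nat.pow_div hl hp.out.pos]

theorem powMultiples_le {l m : ℕ} (h : l ≤ m) : powMultiples p K m ≤ powMultiples p K l :=
  fun _ hx => mem_powMultiples.2 ((mem_powMultiples.1 hx).mono h)

theorem exists_powMultiples_hom {l m : ℕ} (hlm : l ≤ m) (hm : m ≤ K) {C : Type u} [AddCommGroup C]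
    [IsAddCyclic C] (hC : Nat.card C = p ^ (m - l)) :
    ∃ φ : powMultiples p K l →+ C, Function.Surjective φ ∧ ∀ x, φ x = 0 ↔ ModPow m 0 x.1 := by
  have h1 : Nat.card ((powMultiples p K m).addSubgroupOf (powMultiples p K l)) = p ^ (K - m) := by
    rw [Nat.card_congr (AddSubgroup.addSubgroupOfEquivOfLe (powMultiples_le hlm)).toEquiv,
      card_powMultiples hm]
  obtain ⟨φ, hφ, hker⟩ := exists_hom_ker_eq_of_isCyclic_quotient
    (AddSubgroup.toSubgroup ((powMultiples p K m).addSubgroupOf (powMultiples p K l)))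
    (C := Multiplicative C) inferInstance (by
      change Nat.card (powMultiples p K l) = Nat.card C * Nat.card
        ((powMultiples p K m).addSubgroupOf (powMultiples p K l))
      rw [h1, card_powMultiples (hlm.trans hm), hC, ← pow_add]
      congr 1; omega)
  refine ⟨AddMonoidHom.toMultiplicative.symm φ, hφ, fun x => ?_⟩
  have := SetLike.ext_iff.1 hker (Multiplicative.ofAdd x)
  rw [← mem_powMultiples]
  exact this

theorem exists_powMultiples_equiv {l m : ℕ} {C : Type u} [AddCommGroup C]
    {φ : powMultiples p K l →+ C} (hφ : Function.Surjective φ) (hlm : l ≤ m)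
    (hker : ∀ x, φ x = 0 ↔ ModPow m 0 x.1) :
    ∃ ε : powMultiples p K l ≃ C × powMultiples p K m, (∀ x, (ε x).1 = φ x) ∧
      ∀ x y, φ x = φ y → ((ε y).2 - (ε x).2 : ZMod (p ^ K)) = y - x := by
  obtain ⟨s, hs⟩ := hφ.hasRightInverse
  refine ⟨⟨fun x => (φ x, ⟨(x - s (φ x) : powMultiples p K l), mem_powMultiples.2 ((hker _).1 ?_)⟩),
    fun q => s q.1 + ⟨q.2, powMultiples_le hlm q.2.2⟩, fun x => ?_, ?_⟩, fun x => rfl,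
    fun x y h => ?_⟩
  · rw [map_sub, hs, sub_self]
  · ext; simp
  · rintro ⟨q, b, hb⟩
    have h0 := (hker ⟨b, powMultiples_le hlm hb⟩).2 (mem_powMultiples.1 hb)
    have : φ (s q + ⟨b, powMultiples_le hlm hb⟩) = q := by rw [map_add, h0, hs q, add_zero]
    simp [this]
  · simp [h]

theorem RespectsFiltration.mem_modKernel_iff (hP : RespectsFiltration P) (hHP : H ≤ P)
    (hHt : ∀ x, ∃ h ∈ H, h 0 = x) (hHc : ∀ h ∈ H, ∀ k ∈ H, h * k = k * h) {l : ℕ}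
    {h : Equiv.Perm (ZMod (p ^ K))} (hh : h ∈ H) : h ∈ modKernel p K l ↔ ModPow l 0 (h 0) :=
  ⟨fun hk => hk 0, fun hl => hP.regular_mem_modKernel hHP hHt hHc hh hl⟩

theorem RespectsFiltration.card_inf_modKernel (hP : RespectsFiltration P) (hHP : H ≤ P)
    (hH : IsRegularPermGroup H) (hHc : ∀ h ∈ H, ∀ k ∈ H, h * k = k * h) {l : ℕ} (hl : l ≤ K) :
    Nat.card (H ⊓ modKernel p K l : Subgroup _) = p ^ (K - l) := by
  rw [← card_powMultiples hl]
  have hHt : ∀ x, ∃ h ∈ H, h 0 = x := fun x => (hH 0 x).exists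
  refine Nat.card_congr (Equiv.ofBijective (fun h => ⟨h.1 0, mem_powMultiples.2 (h.2.2 0)⟩)
    ⟨fun h k hhk => ?_, fun x => ?_⟩)
  · exact Subtype.ext ((hH 0 (h.1 0)).unique ⟨h.2.1, rfl⟩
      ⟨k.2.1, (congrArg Subtype.val hhk).symm⟩)
  · obtain ⟨h, hh, hx⟩ := hHt x
    refine ⟨⟨h, hh, (hP.mem_modKernel_iff hHP hHt hHc hh).2 ?_⟩, Subtype.ext hx⟩
    rw [hx]; exact mem_powMultiples.1 x.2

/-- The stabilizer move is correct only modulo `p ^ L`; the wreath level `L` removes the remaining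
errors at both points. -/
theorem RespectsFiltration.isWreathLevel_of_pow_mem (hP : RespectsFiltration P)
    (h1 : Equiv.addRight (1 : ZMod (p ^ K)) ∈ P) (hHP : H ≤ P)
    (hHt : ∀ x, ∃ h ∈ H, h 0 = x) (hHc : ∀ h ∈ H, ∀ k ∈ H, h * k = k * h) {i L : ℕ}
    (hi : i + 2 ≤ L) (hL : L ≤ K) {τ : Equiv.Perm (ZMod (p ^ K))} (hτ : τ ∈ H)
    (hτi : ModPow i 0 (τ 0)) (hτi' : ¬ ModPow (i + 1) 0 (τ 0)) (hτp : ModPow L 0 ((τ ^ p) 0))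
    (hW : IsWreathLevel P L) : IsWreathLevel P (i + 1) := by
  intro x y y' hxy hy
  obtain ⟨π, hπ, hx', hy'⟩ :=
    hP.exists_stabilizer_move h1 hHP hHt hHc hi hL hτ hτi hτi' hτp hxy hy
  obtain ⟨ρ, hρ, h3, h4⟩ := hW.exists_move (x := π x) (y := π y) (fun h => hxy
    ((hx'.symm.trans (h.trans hy')).mono (by omega) |>.trans hy.symm)) hx' hy'
  exact ⟨ρ * π, P.mul_mem hρ hπ, h3, h4⟩

/-- Between consecutive wreath levels, the section of a regular abelian subgroup is cyclic. -/
theorem RespectsFiltration.exists_hom_cyclic (hP : RespectsFiltration P)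
    (h1 : Equiv.addRight (1 : ZMod (p ^ K)) ∈ P) (hHP : H ≤ P)
    (hH : IsRegularPermGroup H) (hHc : ∀ h ∈ H, ∀ k ∈ H, h * k = k * h) {l m : ℕ} (hlm : l < m)
    (hm : m ≤ K) (hW : IsWreathLevel P m) (hmin : ∀ i, l < i → i < m → ¬ IsWreathLevel P i)
    {C : Type u} [Group C] [IsCyclic C] (hC : Nat.card C = p ^ (m - l)) :
    ∃ φ : (H ⊓ modKernel p K l : Subgroup _) →* C, Function.Surjective φ ∧
      φ.ker = (H ⊓ modKernel p K m).subgroupOf (H ⊓ modKernel p K l) := by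
  have hHt : ∀ x, ∃ h ∈ H, h 0 = x := fun x => (hH 0 x).exists
  have hle : ∀ {i j : ℕ}, i ≤ j → H ⊓ modKernel p K j ≤ H ⊓ modKernel p K i :=
    fun hij h hh => ⟨hh.1, fun x => (hh.2 x).mono hij⟩
  have hcard : ∀ {i}, l ≤ i → i ≤ K →
      Nat.card ((H ⊓ modKernel p K i).subgroupOf (H ⊓ modKernel p K l)) = p ^ (K - i) := by
    intro i hli hi
    rw [Nat.card_congr (Subgroup.subgroupOfEquivOfLe (hle hli)).toEquiv,
      hP.card_inf_modKernel hHP hH hHc hi]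
  refine IsPGroup.exists_hom_ker_eq (p := p)
    (M := (H ⊓ modKernel p K (m - 1)).subgroupOf (H ⊓ modKernel p K l)) ?_ ?_ ?_ ?_ ?_ ?_
  · rintro ⟨a, ha⟩ ⟨b, hb⟩
    exact Subtype.ext (hHc a ha.1 b hb.1)
  · exact IsPGroup.of_card (hP.card_inf_modKernel hHP hH hHc (hlm.le.trans hm))
  · exact fun x hx => hle (Nat.sub_le m 1) hx
  -- An element violating the claim makes `i + 1` a wreath level strictly between `l` and `m`, where
  -- `p ^ i` is the exact power of `p` dividing `k 0`.
  · rintro ⟨k, hk⟩ hkp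
    by_contra hcon
    have hk1 : ¬ ModPow (m - 1) 0 (k 0) := fun h =>
      hcon ⟨hk.1, (hP.mem_modKernel_iff hHP hHt hHc hk.1).2 h⟩
    classical
    have hex : ∃ j, ¬ ModPow j 0 (k 0) := ⟨_, hk1⟩
    have hj := Nat.find_spec hex
    have hj1 : Nat.find hex ≤ m - 1 := Nat.find_min' hex hk1
    have hj2 : l < Nat.find hex := by
      by_contra! h
      exact hj ((hk.2 0).mono h)
    obtain ⟨i, hi⟩ : ∃ i, Nat.find hex = i + 1 := ⟨Nat.find hex - 1, by omega⟩
    rw [hi] at hj hj1 hj2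
    have hji : ModPow i 0 (k 0) := by
      by_contra h
      have := Nat.find_min' hex h
      omega
    exact hmin (i + 1) hj2 (by omega) (hP.isWreathLevel_of_pow_mem h1 hHP hHt hHc (by omega) hm
      hk.1 hji hj (hkp.2 0) hW)
  · rw [hcard (by omega) (by omega), hcard hlm.le hm, ← pow_succ']
    congr 1; omega
  · rw [hcard hlm.le hm, hP.card_inf_modKernel hHP hH hHc (hlm.le.trans hm), hC, ← pow_add]
    congr 1; omega

end

section

variable {p K : ℕ} [hp : Fact p.Prime] {P H : Subgroup (Equiv.Perm (ZMod (p ^ K)))}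

theorem exists_multiwreath_block_step
    (h1 : Equiv.addRight (1 : ZMod (p ^ K)) ∈ P) {l m : ℕ} (hlm : l < m)
    (hW : IsWreathLevel P m) {C Y : Type u} [AddCommGroup C] [IsAddCyclic C] [Finite C] [Finite Y]
    [Nonempty Y] {c : C} (hc0 : c ≠ 0) (hc : ∀ a : C, ∃ n : ℕ, n • c = a)
    {φ : powMultiples p K l →+ C} (hφ : Function.Surjective φ)
    (hker : ∀ x, φ x = 0 ↔ ModPow m 0 x.1)
    {Δ : Digraph Y} {S : Set (ZMod (p ^ K))} {e : powMultiples p K m ≃ Y} (hΔ : Δ.IsLinked)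
    (hS : ∀ x y, Δ.Adj (e x) (e y) ↔ (y - x : ZMod (p ^ K)) ∈ S)
    (hcl : ∀ σ ∈ digraphAut Δ, ∀ x y : powMultiples p K m, ∃ π ∈ P,
      π x = e.symm (σ (e x)) ∧ π y = e.symm (σ (e y))) :
    ∃ (S' : Set (ZMod (p ^ K))) (e' : powMultiples p K l ≃ C × Y),
      (∀ x y, (cycleWreath c Δ).Adj (e' x) (e' y) ↔ (y - x : ZMod (p ^ K)) ∈ S') ∧
      ∀ σ ∈ digraphAut (cycleWreath c Δ), ∀ x y : powMultiples p K l, ∃ π ∈ P,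
        π x = e'.symm (σ (e' x)) ∧ π y = e'.symm (σ (e' y)) := by
  obtain ⟨ε, hε1, hε2⟩ := exists_powMultiples_equiv hφ hlm.le hker
  have hsub : ∀ x y, φ y = φ x ↔ ModPow m 0 (y - x : ZMod (p ^ K)) := by
    intro x y
    rw [← sub_eq_zero, ← map_sub, hker]; rfl
  set e' : powMultiples p K l ≃ C × Y := ε.trans ((Equiv.refl C).prodCongr e) with he'
  have he1 : ∀ x, (e' x).1 = φ x := fun x => hε1 x
  have he2 : ∀ x, (e' x).2 = e (ε x).2 := fun x => rfl
  refine ⟨{z | ∃ hz : z ∈ powMultiples p K l, φ ⟨z, hz⟩ = c} ∪ {z | ModPow m 0 z ∧ z ∉ S}, e',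
    fun x y => ?_, fun σ hσ x y => ?_⟩
  · refine or_congr ?_ ?_
    · rw [he1, he1, ← sub_eq_iff_eq_add', ← map_sub]
      exact ⟨fun h => ⟨(y - x).2, h⟩, fun ⟨_, h⟩ => h⟩
    · rw [he1, he1, he2, he2, hS, hsub]
      refine and_congr_right fun h => ?_
      rw [hε2 x y ((hsub x y).2 h).symm]
  · rw [digraphAut_cycleWreath hc0 hc hΔ] at hσ
    obtain ⟨g, hg, h, hh, hgh⟩ := hσ
    obtain ⟨d, hd⟩ := mem_translations.1 hg
    have hσe : ∀ z, σ (e' z) = (d + φ z, h (φ z) (e (ε z).2)) := by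
      intro z
      rw [← Prod.mk.eta (p := e' z), hgh, hd, he1, he2]
    have hφσ : ∀ z, φ (e'.symm (σ (e' z))) = d + φ z := by
      intro z
      rw [← he1, Equiv.apply_symm_apply, hσe]
    have hεσ : ∀ z, (ε (e'.symm (σ (e' z)))).2 = e.symm (h (φ z) (e (ε z).2)) := by
      intro z
      rw [Equiv.eq_symm_apply, ← he2, Equiv.apply_symm_apply, hσe]
    -- Points in one class modulo `p ^ m` are translated into the inductive block, moved there, and
    -- translated back. Points in different classes are shifted by a common `t` and then adjusted
    -- independently, as `m` is a wreath level.
    by_cases hxy : φ x = φ y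
    · obtain ⟨π, hπ, hπx, hπy⟩ := hcl (h (φ x)) (hh _) (ε x).2 (ε y).2
      set X := e'.symm (σ (e' x)) with hX
      set Y' := e'.symm (σ (e' y)) with hY
      have h2 := hε2 X Y' (by rw [hφσ, hφσ, hxy])
      have h3 := hε2 x y hxy
      rw [← hεσ] at hπx
      rw [show e.symm (h (φ x) (e (ε y).2)) = (ε Y').2 by rw [hεσ, hxy]] at hπy
      rw [← hX] at hπx
      refine ⟨Equiv.addRight (X - (ε X).2 : ZMod (p ^ K)) * π *
        Equiv.addRight ((ε x).2 - x : ZMod (p ^ K)),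
        P.mul_mem (P.mul_mem (addRight_mem h1 _) hπ) (addRight_mem h1 _), ?_, ?_⟩
      · have : (x + ((ε x).2 - x) : ZMod (p ^ K)) = (ε x).2 := by ring
        simp only [Equiv.Perm.mul_apply, Equiv.coe_addRight, this, hπx]
        ring
      · have : (y + ((ε x).2 - x) : ZMod (p ^ K)) = (ε y).2 := by linear_combination -h3
        simp only [Equiv.Perm.mul_apply, Equiv.coe_addRight, this, hπy]
        linear_combination h2
    · obtain ⟨t, ht⟩ := hφ d
      have hmod : ∀ z : powMultiples p K l, ModPow m (z + t : ZMod (p ^ K)) (e'.symm (σ (e' z))) := by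
        intro z
        have h2 := (hsub (z + t) (e'.symm (σ (e' z)))).1 (by rw [hφσ, map_add, ht, add_comm])
        simpa [ModPow] using h2
      have hne : ¬ ModPow m (x + t : ZMod (p ^ K)) (y + t) := by
        intro h2
        refine hxy ((hsub x y).2 ?_).symm
        simpa [ModPow] using h2
      obtain ⟨π, hπ, hπx, hπy⟩ := hW.exists_move hne (hmod x) (hmod y)
      exact ⟨π * Equiv.addRight (t : ZMod (p ^ K)), P.mul_mem hπ (addRight_mem h1 _), hπx, hπy⟩

theorem exists_multiwreath_block (hP : RespectsFiltration P)
    (h1 : Equiv.addRight (1 : ZMod (p ^ K)) ∈ P) (hHP : H ≤ P)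
    (hH : IsRegularPermGroup H) (hHc : ∀ h ∈ H, ∀ k ∈ H, h * k = k * h) (l : ℕ) (hl : l ≤ K) :
    ∃ (Y : Type u) (_ : Finite Y) (_ : Nonempty Y) (Δ : Digraph Y) (S : Set (ZMod (p ^ K)))
      (e : powMultiples p K l ≃ Y), Δ.IsLinked ∧ IsMultiwreathOfCyclic (digraphAut Δ) ∧
      (∀ x y, Δ.Adj (e x) (e y) ↔ (y - x : ZMod (p ^ K)) ∈ S) ∧
      IsCayleyDigraphOf Δ (H ⊓ modKernel p K l : Subgroup _) ∧
      ∀ σ ∈ digraphAut Δ, ∀ x y : powMultiples p K l, ∃ π ∈ P,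
        π x = e.symm (σ (e x)) ∧ π y = e.symm (σ (e y)) := by
  induction hd : K - l using Nat.strong_induction_on generalizing l with
  | _ d ih =>
  rcases hl.eq_or_lt with rfl | hlK
  · have hz : ∀ x : powMultiples p l l, x = 0 := fun x =>
      Subtype.ext (ModPow.top_iff.1 (mem_powMultiples.1 x.2)).symm
    have hk : ∀ k : (H ⊓ modKernel p l l : Subgroup _), k = 1 := fun k =>
      Subtype.ext (Equiv.ext fun x => (ModPow.top_iff.1 (k.2.2 x)).symm)
    -- The single vertex carries a loop, since the base digraph must have no sink.
    refine ⟨PUnit, inferInstance, inferInstance, ⟨fun _ _ => True⟩, Set.univ,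
      ⟨fun _ => PUnit.unit, fun _ => 0, fun x => (hz x).symm, fun _ => rfl⟩,
      ⟨fun y => ⟨y, trivial⟩, fun R hR _ y z => hR.refl _⟩, ?_, fun x y => by simp, ?_, ?_⟩
    · refine .cyclic _ ?_ fun x y => ⟨1, ⟨one_mem _, rfl⟩, fun σ _ => Subsingleton.elim _ _⟩
      infer_instance
    · rw [isCayleyDigraphOf_iff]
      exact ⟨Set.univ, ⟨fun _ => 1, fun _ => PUnit.unit, fun _ => rfl, fun k => (hk k).symm⟩,
        fun x y => by simp⟩
    · intro σ _ x y
      exact ⟨1, P.one_mem, by rw [hz x]; rfl, by rw [hz y]; rfl⟩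
  · classical
    have hWK : IsWreathLevel P K := fun x y y' _ h => ⟨1, P.one_mem, rfl, ModPow.top_iff.1 h⟩
    -- The next level is the least wreath level above `l`; `K` is one because its classes are
    -- singletons.
    have hex : ∃ m, l < m ∧ IsWreathLevel P m := ⟨K, hlK, hWK⟩
    obtain ⟨hlm, hW⟩ := Nat.find_spec hex
    have hmK : Nat.find hex ≤ K := Nat.find_min' hex ⟨hlK, hWK⟩
    have hmin : ∀ i, l < i → i < Nat.find hex → ¬ IsWreathLevel P i := fun i hi him hWi =>
      absurd (Nat.find_min' hex ⟨hi, hWi⟩) (by omega)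
    generalize Nat.find hex = m at hlm hW hmK hmin
    obtain ⟨Y, _, _, Δ, S, e, hΔ, hmw, hS, hcay, hcl⟩ := ih (K - m) (by omega) m hmK rfl
    have : IsAddCyclic (ULift.{u} (ZMod (p ^ (m - l)))) :=
      isAddCyclic_of_surjective (AddEquiv.ulift (α := ZMod (p ^ (m - l)))).symm
        (AddEquiv.surjective _)
    have hcard : Nat.card (ULift.{u} (ZMod (p ^ (m - l)))) = p ^ (m - l) := by simp
    have hc : ∀ a : ULift.{u} (ZMod (p ^ (m - l))), ∃ n : ℕ, n • (⟨1⟩ : ULift (ZMod _)) = a :=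
      fun a => ⟨a.down.val, ULift.down_injective (by
        change a.down.val • (1 : ZMod (p ^ (m - l))) = a.down
        simp)⟩
    have hc0 : (⟨1⟩ : ULift.{u} (ZMod (p ^ (m - l)))) ≠ 0 := by
      intro h
      have h2 : (1 : ZMod (p ^ (m - l))) = 0 := congrArg ULift.down h
      have : Fact (1 < p ^ (m - l)) := ⟨Nat.one_lt_pow (by omega) hp.out.one_lt⟩
      exact one_ne_zero h2
    obtain ⟨φ, hφ, hker⟩ := exists_powMultiples_hom hlm.le hmK hcard
    obtain ⟨S', e', hS', hcl'⟩ :=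
      exists_multiwreath_block_step h1 hlm hW hc0 hc hφ hker hΔ hS hcl
    obtain ⟨ψ, hψ, hψk⟩ := hP.exists_hom_cyclic h1 hHP hH hHc hlm hmK hW hmin
      (C := Multiplicative (ULift.{u} (ZMod (p ^ (m - l))))) hcard
    refine ⟨_, inferInstance, inferInstance, cycleWreath ⟨1⟩ Δ, S', e',
      cycleWreath_isLinked hc Δ, cycleWreath_isMultiwreath hc0 hc hΔ hmw, hS',
      isCayleyDigraphOf_cycleWreath ψ hψ ?_, hcl'⟩
    have hle : H ⊓ modKernel p K m ≤ H ⊓ modKernel p K l :=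
      fun h hh => ⟨hh.1, fun x => (hh.2 x).mono hlm.le⟩
    exact hcay.congr ((Subgroup.subgroupOfEquivOfLe hle).symm.trans
      (MulEquiv.subgroupCongr hψk.symm))

/-- A `p`-group of permutations of `ZMod (p ^ K)` containing the translations and a regular abelian
subgroup `H` has in its `2`-closure the automorphism group of a Cayley digraph, both of the cyclic
group and of `H`, which is a multiwreath product of cyclic groups. -/
theorem IsPGroup.exists_multiwreath (hP : IsPGroup p P)
    (h1 : Equiv.addRight (1 : ZMod (p ^ K)) ∈ P) (hHP : H ≤ P)
    (hH : IsRegularPermGroup H) (hHc : ∀ h ∈ H, ∀ k ∈ H, h * k = k * h) :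
    ∃ (Y : Type u) (Δ : Digraph Y) (e : ZMod (p ^ K) ≃ Y), IsMultiwreathOfCyclic (digraphAut Δ) ∧
      IsCayleyDigraphOf Δ (Multiplicative (ZMod (p ^ K))) ∧ IsCayleyDigraphOf Δ H ∧
      ∀ σ ∈ digraphAut Δ, ∀ x y, ∃ π ∈ P, e (π x) = σ (e x) ∧ e (π y) = σ (e y) := by
  obtain ⟨Y, _, _, Δ, S, e, -, hmw, hS, hcay, hcl⟩ :=
    exists_multiwreath_block (hP.respectsFiltration h1) h1 hHP hH hHc 0 (Nat.zero_le K)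
  have htop : ∀ x, x ∈ powMultiples p K 0 := fun x => mem_powMultiples.2 (ModPow.zero _ _)
  let ε : ZMod (p ^ K) ≃ powMultiples p K 0 := ⟨fun x => ⟨x, htop x⟩, fun x => x.1, fun _ => rfl,
    fun _ => rfl⟩
  refine ⟨Y, Δ, ε.trans e, hmw, ?_, ?_, fun σ hσ x y => ?_⟩
  · rw [isCayleyDigraphOf_iff]
    refine ⟨Multiplicative.toAdd ⁻¹' S, (ε.trans e).symm.trans Multiplicative.ofAdd,
      fun x y => ?_⟩
    have h2 := hS (e.symm x) (e.symm y)
    rw [Equiv.apply_symm_apply, Equiv.apply_symm_apply] at h2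
    rw [h2, sub_eq_neg_add]
    rfl
  · refine hcay.congr (MulEquiv.subgroupCongr ?_)
    exact inf_eq_left.2 fun h _ x => ModPow.zero _ _
  · obtain ⟨π, hπ, hx, hy⟩ := hcl σ hσ (ε x) (ε y)
    refine ⟨π, hπ, ?_, ?_⟩
    · have : ε (π x) = e.symm (σ (e (ε x))) := Subtype.ext hx
      simp [this]
    · have : ε (π y) = e.symm (σ (e (ε y))) := Subtype.ext hy
      simp [this]

end

/-! ### Reduction of nilpotent groups to single coordinates. -/

/-- A permutation of the `i`-th factor, acting on the `i`-th coordinate of `X ≃ ∀ i, V i`. -/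
def coordHom {ι : Type w} [DecidableEq ι] {V : ι → Type v} {X : Type u} (κ : (∀ i, V i) ≃ X)
    (i : ι) : Equiv.Perm (V i) →* Equiv.Perm X where
  toFun σ := κ.permCongr (Equiv.piCongrRight (Pi.mulSingle (M := fun i => Equiv.Perm (V i)) i σ))
  map_one' := by
    ext x
    simp only [Pi.mulSingle_one]
    exact κ.apply_symm_apply x
  map_mul' σ τ := by
    ext x
    simp only [Equiv.permCongr_apply, Equiv.Perm.mul_apply, Equiv.symm_apply_apply, Pi.mulSingle_mul]
    rfl

section coord

variable {ι : Type w} [DecidableEq ι] {V : ι → Type v} {X : Type u} (κ : (∀ i, V i) ≃ X)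

theorem coordHom_apply (i : ι) (σ : Equiv.Perm (V i)) (z : ∀ i, V i) :
    coordHom κ i σ (κ z) = κ (Function.update z i (σ (z i))) := by
  simp only [coordHom, MonoidHom.coe_mk, OneHom.coe_mk, Equiv.permCongr_apply,
    Equiv.symm_apply_apply]
  congr 1
  ext j
  by_cases h : j = i
  · subst h; simp
  · simp [h]

theorem coordHom_injective [∀ i, Nonempty (V i)] (i : ι) :
    Function.Injective (coordHom κ i) := by
  intro σ τ h
  ext v
  obtain ⟨z⟩ : Nonempty (∀ i, V i) := inferInstance
  have h1 := congrArg (fun π : Equiv.Perm X => π (κ (Function.update z i v))) h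
  simp only [coordHom_apply, EmbeddingLike.apply_eq_iff_eq] at h1
  simpa using congrFun h1 i

/-- To preserve a relation coordinatewise it suffices to agree, on every two points and in each
coordinate, with single-coordinate permutations that preserve the relation. -/
theorem digraphAut_of_coord [Finite ι] {Γ : Digraph X} (τ : ∀ i, Equiv.Perm (V i))
    (h : ∀ i x y, ∃ π : Equiv.Perm (V i), coordHom κ i π ∈ digraphAut Γ ∧ π x = τ i x ∧
      π y = τ i y) : κ.permCongr (Equiv.piCongrRight τ) ∈ digraphAut Γ := by
  have := Fintype.ofFinite ι
  -- Applying `τ` one coordinate at a time lets the witness `π` vary with the coordinate and with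
  -- the pair of points.
  let A : Finset ι → (∀ i, V i) → ∀ i, V i := fun s z j => if j ∈ s then τ j (z j) else z j
  have key : ∀ s z z', Γ.Adj (κ (A s z)) (κ (A s z')) ↔ Γ.Adj (κ z) (κ z') := by
    intro s
    induction s using Finset.induction_on with
    | empty => intro z z'; simp [A]
    | insert i s his ih =>
      intro z z'
      rw [← ih z z']
      obtain ⟨π, hπ, h1, h2⟩ := h i (z i) (z' i)
      have h3 : ∀ y : ∀ i, V i, π (y i) = τ i (y i) →
          κ (A (insert i s) y) = coordHom κ i π (κ (A s y)) := by
        intro y hy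
        rw [coordHom_apply]
        congr 1
        ext j
        by_cases hj : j = i
        · subst hj; simp [A, his, hy]
        · simp [A, hj]
      rw [h3 z h1, h3 z' h2]
      exact hπ _ _
  intro x y
  have := key Finset.univ (κ.symm x) (κ.symm y)
  have h4 : ∀ x, κ (A Finset.univ (κ.symm x)) = κ.permCongr (Equiv.piCongrRight τ) x := by
    intro x
    simp only [A, Finset.mem_univ, if_true, Equiv.permCongr_apply]
    rfl
  rw [← h4, ← h4, this]
  simp

end coord

section nilpotent

variable {N : Type u} [Group N] [Finite N] [Group.IsNilpotent N]

theorem Sylow.mem_of_pow_eq_one {q : ℕ} [Fact q.Prime] (S : Sylow q N) {t : N} {k : ℕ}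
    (ht : t ^ q ^ k = 1) : t ∈ S := by
  have h1 : IsPGroup q (Subgroup.zpowers t) := by
    rintro ⟨y, n, rfl⟩
    refine ⟨k, Subtype.ext ?_⟩
    simp only [Subgroup.coe_pow, Subgroup.coe_one]
    rw [← zpow_natCast, ← zpow_mul, mul_comm, zpow_mul, zpow_natCast, ht, one_zpow]
  obtain ⟨Q, hQ⟩ := h1.exists_le_sylow
  have := Sylow.unique_of_normal S inferInstance
  rw [Subsingleton.elim S Q]
  exact hQ (Subgroup.mem_zpowers t)

theorem commute_of_prime_pow_eq_one {q q' : ℕ} [Fact q.Prime] [Fact q'.Prime] (hqq : q ≠ q')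
    {s t : N} {k l : ℕ} (hs : s ^ q ^ k = 1) (ht : t ^ q' ^ l = 1) : Commute s t := by
  obtain ⟨S⟩ : Nonempty (Sylow q N) := inferInstance
  obtain ⟨T⟩ : Nonempty (Sylow q' N) := inferInstance
  exact Subgroup.commute_of_normal_of_disjoint (S : Subgroup N) T inferInstance inferInstance
    (IsPGroup.disjoint_of_ne q q' hqq _ _ S.isPGroup' T.isPGroup') s t
    (S.mem_of_pow_eq_one hs) (T.mem_of_pow_eq_one ht)

end nilpotent

theorem dvd_pow_of_pow_dvd_prod {r : ℕ} {p a : Fin r → ℕ} (hp : ∀ i, (p i).Prime)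
    (hinj : Function.Injective p) {i : Fin r} {k : ℕ} (h : p i ^ k ∣ ∏ j, p j ^ a j) :
    p i ^ k ∣ p i ^ a i := by
  rw [← Finset.mul_prod_erase _ _ (Finset.mem_univ i)] at h
  refine Nat.Coprime.dvd_of_dvd_mul_right ?_ h
  refine Nat.Coprime.prod_right fun j hj => Nat.Coprime.pow _ _ ?_
  exact (Nat.coprime_primes (hp i) (hp j)).2 fun h => (Finset.ne_of_mem_erase hj) (hinj h).symm

theorem Sylow.card_of_card_eq_prod {r : ℕ} {p a : Fin r → ℕ} (hp : ∀ i, (p i).Prime)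
    (hinj : Function.Injective p) {K : Type u} [Group K] [Finite K]
    (hK : Nat.card K = ∏ j, p j ^ a j) (i : Fin r) (S : Sylow (p i) K) :
    Nat.card S = p i ^ a i := by
  have : Fact (p i).Prime := ⟨hp i⟩
  rw [S.card_eq_multiplicity]
  refine Nat.dvd_antisymm (dvd_pow_of_pow_dvd_prod hp hinj ?_) ?_
  · rw [← hK]; exact Nat.ordProj_dvd _ _
  · refine pow_dvd_pow _ (((hp i).pow_dvd_iff_le_factorization Nat.card_pos.ne').1 ?_)
    rw [hK]; exact Finset.dvd_prod_of_mem _ (Finset.mem_univ i)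

section reduction

variable {X : Type u} [Finite X] {r : ℕ} {p a : Fin r → ℕ} [hp : ∀ i, Fact (p i).Prime]

/-- An element of `p i`-power order in a nilpotent group containing the translations acts on the
`i`-th coordinate only. -/
theorem exists_coordHom_eq (hinj : Function.Injective p) (hn : Nat.card X = ∏ i, p i ^ a i)
    {N : Subgroup (Equiv.Perm X)} (hN : Group.IsNilpotent N)
    (κ : (∀ i, ZMod (p i ^ a i)) ≃ X)
    (T : Multiplicative (∀ i, ZMod (p i ^ a i)) →* Equiv.Perm X) (hTN : ∀ w, T w ∈ N)
    (hT : ∀ w z, T (Multiplicative.ofAdd w) (κ z) = κ (w + z)) (i : Fin r) {s : Equiv.Perm X}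
    (hs : s ∈ N) {k : ℕ} (hsk : s ^ p i ^ k = 1) : ∃ σ, coordHom κ i σ = s := by
  have hpow : ∀ j (v : ZMod (p j ^ a j)),
      (T (Multiplicative.ofAdd (Pi.single j v))) ^ p j ^ a j = 1 := by
    intro j v
    rw [← map_pow, ← ofAdd_nsmul]
    have : (p j ^ a j) • (Pi.single j v : ∀ i, ZMod (p i ^ a i)) = 0 := by
      ext l
      by_cases h : l = j
      · subst h
        simp only [Pi.smul_apply, nsmul_eq_mul, ZMod.natCast_self, Pi.single_eq_same, zero_mul,
          Pi.zero_apply]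
      · simp [Pi.single_eq_of_ne h]
    rw [this, ofAdd_zero, map_one]
  have hcomm : ∀ w : ∀ i, ZMod (p i ^ a i), w i = 0 → Commute s (T (Multiplicative.ofAdd w)) := by
    intro w hw
    rw [← Finset.univ_sum_single w]
    induction (Finset.univ : Finset (Fin r)) using Finset.induction_on with
    | empty => simp
    | insert j t hjt ih =>
      rw [Finset.sum_insert hjt, ofAdd_add, map_mul]
      refine Commute.mul_right ?_ ih
      by_cases hj : j = i
      · subst hj; rw [hw]; simp
      · have h1 := commute_of_prime_pow_eq_one (N := N) (q := p i) (q' := p j)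
          (fun h => hj (hinj h).symm) (s := ⟨s, hs⟩) (t := ⟨_, hTN _⟩) (k := k) (l := a j)
          (Subtype.ext hsk) (Subtype.ext (hpow j (w j)))
        exact congrArg Subtype.val h1
  -- The orbit of the normal Sylow subgroup is a block of `p i`-power size dividing `Nat.card X`,
  -- and it contains the line in direction `i`; by size it equals that line.
  have horb : ∀ z, ∃ v, s (κ z) = κ (Function.update z i v) := by
    intro z
    obtain ⟨S⟩ : Nonempty (Sylow (p i) N) := inferInstance
    have htr : MulAction.IsPretransitive N X := by
      refine ⟨fun x y => ⟨⟨_, hTN (Multiplicative.ofAdd (κ.symm y - κ.symm x))⟩, ?_⟩⟩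
      have := hT (κ.symm y - κ.symm x) (κ.symm x)
      rw [Equiv.apply_symm_apply, sub_add_cancel, Equiv.apply_symm_apply] at this
      exact this
    set B := MulAction.orbit (S : Subgroup N) (κ z) with hB
    have hBd : B.ncard ∣ ∏ j, p j ^ a j := by
      rw [← hn]
      exact (MulAction.IsBlock.orbit_of_normal (G := N) (κ z)).ncard_dvd_card
        ⟨_, MulAction.mem_orbit_self _⟩
    obtain ⟨e, he⟩ := S.isPGroup'.card_orbit (κ z)
    have hBc : B.ncard = p i ^ e := he
    rw [hBc] at hBd
    have hle : B.ncard ≤ p i ^ a i := by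
      rw [hBc]
      exact Nat.le_of_dvd (pow_pos (hp i).out.pos _)
        (dvd_pow_of_pow_dvd_prod (fun i => (hp i).out) hinj hBd)
    have hsub : (Set.range fun v => κ (Function.update z i v)) ⊆ B := by
      rintro _ ⟨v, rfl⟩
      refine ⟨⟨⟨_, hTN (Multiplicative.ofAdd (Pi.single i (v - z i)))⟩,
        S.mem_of_pow_eq_one (Subtype.ext (hpow i _))⟩, ?_⟩
      refine (hT _ _).trans (congrArg κ ?_)
      ext j
      by_cases hj : j = i
      · subst hj; simp
      · simp [hj]
    have hcr : (Set.range fun v => κ (Function.update z i v)).ncard = p i ^ a i := by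
      have h2 : Function.Injective fun v => κ (Function.update z i v) :=
        κ.injective.comp (Function.update_injective z i)
      rw [← Set.image_univ, Set.ncard_image_of_injective _ h2, Set.ncard_univ, Nat.card_zmod]
    have heq := Set.eq_of_subset_of_ncard_le hsub (by rw [hcr]; exact hle) (Set.toFinite _)
    have hmem : s (κ z) ∈ B := ⟨⟨⟨s, hs⟩, S.mem_of_pow_eq_one (Subtype.ext hsk)⟩, rfl⟩
    rw [← heq] at hmem
    obtain ⟨v, hv⟩ := hmem
    exact ⟨v, hv.symm⟩
  -- The action on one line determines `s`, since `s` commutes with the translations that fix the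
  -- `i`-th coordinate.
  choose F hF using fun v : ZMod (p i ^ a i) => horb (Pi.single i v)
  have hFz : ∀ z, s (κ z) = κ (Function.update z i (F (z i))) := by
    intro z
    have h1 := congrArg (fun π : Equiv.Perm X => π (κ (Pi.single i (z i))))
      (hcomm (z - Pi.single i (z i)) (by simp)).eq
    simp only [Equiv.Perm.mul_apply, hT, sub_add_cancel, hF] at h1
    rw [h1]
    congr 1
    ext j
    by_cases hj : j = i
    · subst hj; simp
    · simp [hj]
  have hFinj : Function.Injective F := by
    intro v w hvw
    have h1 := hF v
    rw [hvw] at h1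
    have h2 : Function.update (Pi.single i v : ∀ i, ZMod (p i ^ a i)) i (F w) =
        Function.update (Pi.single i w) i (F w) := by
      simp [Pi.single]
    rw [h2, ← hF w] at h1
    simpa using congrFun (κ.injective (s.injective h1)) i
  refine ⟨Equiv.ofBijective F (Finite.injective_iff_bijective.1 hFinj), ?_⟩
  ext x
  obtain ⟨z, rfl⟩ := κ.surjective x
  rw [coordHom_apply, hFz]
  rfl

end reduction

theorem IsRegularPermGroup.bijective_apply {X : Type u} {G : Subgroup (Equiv.Perm X)}
    (hG : IsRegularPermGroup G) (x : X) : Function.Bijective fun g : G => g.1 x := by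
  refine ⟨fun g h hgh => Subtype.ext ((hG x (h.1 x)).unique ⟨g.2, hgh⟩ ⟨h.2, rfl⟩), fun y => ?_⟩
  obtain ⟨σ, hσ, hy⟩ := (hG x y).exists
  exact ⟨⟨σ, hσ⟩, hy⟩

theorem IsRegularPermGroup.card_eq {X : Type u} {G : Subgroup (Equiv.Perm X)} [hX : Nonempty X]
    (hG : IsRegularPermGroup G) : Nat.card G = Nat.card X :=
  Nat.card_congr (Equiv.ofBijective _ (hG.bijective_apply hX.some))

theorem exists_translation_coordinates {X : Type u} {r : ℕ} {p a : Fin r → ℕ}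
    [hp : ∀ i, Fact (p i).Prime] (hinj : Function.Injective p)
    (hn : Nat.card X = ∏ i, p i ^ a i) {G : Subgroup (Equiv.Perm X)} (hG : IsCyclic G)
    (hGr : IsRegularPermGroup G) :
    ∃ (κ : (∀ i, ZMod (p i ^ a i)) ≃ X)
      (T : Multiplicative (∀ i, ZMod (p i ^ a i)) →* Equiv.Perm X), (∀ w, T w ∈ G) ∧
      ∀ w z, T (Multiplicative.ofAdd w) (κ z) = κ (w + z) := by
  have hX : Nonempty X := by
    refine (Nat.card_pos_iff.1 ?_).1
    rw [hn]
    exact Finset.prod_pos fun i _ => pow_pos (hp i).out.pos _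
  obtain ⟨x0⟩ := hX
  have hb := hGr.bijective_apply x0
  have hcard : Nat.card G = ∏ i, p i ^ a i := by
    rw [← hn]; exact Nat.card_congr (Equiv.ofBijective _ hb)
  let ρ : ZMod (Nat.card G) ≃+* ∀ i, ZMod (p i ^ a i) := (ZMod.ringEquivCongr hcard).trans
    (ZMod.prodEquivPi (fun i => p i ^ a i) fun i j hij =>
      Nat.Coprime.pow _ _ ((Nat.coprime_primes (hp i).out (hp j).out).2 fun h => hij (hinj h)))
  let ψ : Multiplicative (∀ i, ZMod (p i ^ a i)) ≃* G :=
    (AddEquiv.toMultiplicative ρ.symm.toAddEquiv).trans (zmodCyclicMulEquiv hG)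
  refine ⟨Multiplicative.ofAdd.trans (ψ.toEquiv.trans (Equiv.ofBijective _ hb)),
    G.subtype.comp ψ.toMonoidHom, fun w => (ψ w).2, fun w z => ?_⟩
  simp

section

variable {X : Type u} [Finite X] {r : ℕ} {p a : Fin r → ℕ} [hp : ∀ i, Fact (p i).Prime]

theorem exists_coord_multiwreath (hinj : Function.Injective p)
    (hn : Nat.card X = ∏ i, p i ^ a i) {N : Subgroup (Equiv.Perm X)} (hN : Group.IsNilpotent N)
    (κ : (∀ i, ZMod (p i ^ a i)) ≃ X)
    (T : Multiplicative (∀ i, ZMod (p i ^ a i)) →* Equiv.Perm X) (hTN : ∀ w, T w ∈ N)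
    (hT : ∀ w z, T (Multiplicative.ofAdd w) (κ z) = κ (w + z))
    {H : Subgroup (Equiv.Perm X)} (hHN : H ≤ N) (hH : IsRegularPermGroup H)
    (hHc : ∀ h ∈ H, ∀ k ∈ H, h * k = k * h) (i : Fin r) (Q : Subgroup H) (hQ : IsPGroup (p i) Q)
    (hQcard : Nat.card Q = p i ^ a i) :
    ∃ (Y : Type u) (Δ : Digraph Y) (e : ZMod (p i ^ a i) ≃ Y),
      IsMultiwreathOfCyclic (digraphAut Δ) ∧
      IsCayleyDigraphOf Δ (Multiplicative (ZMod (p i ^ a i))) ∧ IsCayleyDigraphOf Δ Q ∧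
      ∀ σ ∈ digraphAut Δ, ∀ x y, ∃ π, coordHom κ i π ∈ N ∧
        e (π x) = σ (e x) ∧ e (π y) = σ (e y) := by
  have hinjc := coordHom_injective κ i
  obtain ⟨S⟩ : Nonempty (Sylow (p i) N) := inferInstance
  set S' : Subgroup (Equiv.Perm X) := (S : Subgroup N).map N.subtype with hS'
  have hmemS' : ∀ t ∈ N, ∀ k, t ^ p i ^ k = 1 → t ∈ S' := fun t ht k htk =>
    ⟨⟨t, ht⟩, S.mem_of_pow_eq_one (Subtype.ext htk), rfl⟩
  have hP : IsPGroup (p i) (S'.comap (coordHom κ i)) :=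
    (S.isPGroup'.map N.subtype).comap_of_injective _ hinjc
  have h1 : Equiv.addRight (1 : ZMod (p i ^ a i)) ∈ S'.comap (coordHom κ i) := by
    rw [Subgroup.mem_comap]
    have h2 : coordHom κ i (Equiv.addRight (1 : ZMod (p i ^ a i))) =
        T (Multiplicative.ofAdd (Pi.single i 1)) := by
      ext x
      obtain ⟨z, rfl⟩ := κ.surjective x
      rw [hT, coordHom_apply]
      congr 1
      ext j
      by_cases hj : j = i
      · subst hj; simp [add_comm]
      · simp [hj]
    refine hmemS' _ (by rw [h2]; exact hTN _) (a i) ?_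
    rw [← map_pow]
    have h3 : ∀ (n : ℕ) (x : ZMod (p i ^ a i)), ((Equiv.addRight 1) ^ n : Equiv.Perm _) x = x + n := by
      intro n
      induction n with
      | zero => simp
      | succ n ih =>
        intro x
        rw [pow_succ', Equiv.Perm.mul_apply, ih]
        simp [add_assoc]
    have h4 : ((Equiv.addRight (1 : ZMod (p i ^ a i))) ^ p i ^ a i : Equiv.Perm _) = 1 := by
      ext x
      rw [h3]
      simp only [ZMod.natCast_self, add_zero, Equiv.Perm.coe_one, id_eq]
    rw [h4, map_one]
  set Q' : Subgroup (Equiv.Perm X) := Q.map H.subtype with hQ'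
  have hQ'H : Q' ≤ H := by
    rintro _ ⟨q, -, rfl⟩; exact q.2
  have hQ'p : ∀ q ∈ Q', ∃ k, q ^ p i ^ k = 1 := by
    rintro _ ⟨q, hq, rfl⟩
    obtain ⟨k, hk⟩ := hQ ⟨q, hq⟩
    exact ⟨k, congrArg (fun x : Q => ((x : H) : Equiv.Perm X)) hk⟩
  have hQ'S : Q' ≤ S' := by
    intro q hq
    obtain ⟨k, hk⟩ := hQ'p q hq
    exact hmemS' q (hHN (hQ'H hq)) k hk
  have hbij : Function.Bijective ((coordHom κ i).subgroupComap Q') := by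
    refine ⟨fun x y hxy => Subtype.ext (hinjc (congrArg Subtype.val hxy)), ?_⟩
    rintro ⟨q, hq⟩
    obtain ⟨k, hk⟩ := hQ'p q hq
    obtain ⟨σ, hσ⟩ := exists_coordHom_eq hinj hn hN κ T hTN hT i (hHN (hQ'H hq)) hk
    exact ⟨⟨σ, by rw [Subgroup.mem_comap, hσ]; exact hq⟩, Subtype.ext hσ⟩
  let ε : Q'.comap (coordHom κ i) ≃* Q := (MulEquiv.ofBijective _ hbij).trans
    (Q.equivMapOfInjective H.subtype H.subtype_injective).symm
  -- Freeness is inherited from `H`; transitivity follows by counting.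
  have hreg : IsRegularPermGroup (Q'.comap (coordHom κ i)) := by
    have hfree : ∀ x, ∀ σ ∈ Q'.comap (coordHom κ i), ∀ τ ∈ Q'.comap (coordHom κ i),
        σ x = τ x → σ = τ := by
      intro x σ hσ τ hτ h
      refine hinjc ((hH (κ (Pi.single i x)) _).unique ⟨hQ'H hσ, rfl⟩ ⟨hQ'H hτ, ?_⟩)
      rw [coordHom_apply, coordHom_apply, Pi.single_eq_same, h]
    intro x y
    have hb : Function.Bijective fun σ : Q'.comap (coordHom κ i) => σ.1 x := by
      refine (Nat.bijective_iff_injective_and_card _).2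
        ⟨fun σ τ h => Subtype.ext (hfree x _ σ.2 _ τ.2 h), ?_⟩
      rw [Nat.card_congr ε.toEquiv, hQcard, Nat.card_zmod]
    obtain ⟨σ, hσ⟩ := hb.2 y
    exact ⟨σ, ⟨σ.2, hσ⟩, fun τ hτ => hfree x _ hτ.1 _ σ.2 (hτ.2.trans hσ.symm)⟩
  obtain ⟨Y, Δ, e, hmw, hZ, hQc, hcl⟩ := hP.exists_multiwreath h1
    (H := Q'.comap (coordHom κ i)) (Subgroup.comap_mono hQ'S) hreg
    (fun σ hσ τ hτ => hinjc (by rw [map_mul, map_mul, hHc _ (hQ'H hσ) _ (hQ'H hτ)]))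
  refine ⟨Y, Δ, e, hmw, hZ, hQc.congr ε, fun σ hσ x y => ?_⟩
  obtain ⟨π, ⟨s, -, hs⟩, h⟩ := hcl σ hσ x y
  exact ⟨π, hs ▸ s.2, h⟩

end

/-! ### Assembly of the two items. -/

/-- A digraph of product type with Cayley factors is a Cayley digraph of the product group. -/
theorem IsOfProductType.isCayleyDigraphOf_pi {X : Type u} {r : ℕ} {V : Fin r → Type v}
    {Γ : Digraph X} {Δ : ∀ i, Digraph (V i)} (h : IsOfProductType Γ Δ) {K : Fin r → Type w}
    [∀ i, Group (K i)] (hΔ : ∀ i, IsCayleyDigraphOf (Δ i) (K i)) :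
    IsCayleyDigraphOf Γ (∀ i, K i) := by
  obtain ⟨e, he⟩ := h
  simp only [isCayleyDigraphOf_iff] at hΔ ⊢
  choose S f hf using hΔ
  let β : X ≃ ∀ i, K i := e.symm.trans (Equiv.piCongrRight f)
  refine ⟨{s | Γ.Adj (β.symm 1) (β.symm s)}, β, fun x y => ?_⟩
  -- Left multiplication by the inverse of `β x` in every coordinate carries `x` to the identity and
  -- preserves `Γ`.
  let σ : ∀ i, Equiv.Perm (V i) := fun i => (f i).symm.permCongr (Equiv.mulLeft (β x i)⁻¹)
  have hσ : ∀ i, σ i ∈ digraphAut (Δ i) := by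
    intro i x y
    simp [hf, σ]
  have h1 := he σ hσ x y
  have h2 : ∀ y, e.permCongr (Equiv.piCongrRight σ) y = β.symm ((β x)⁻¹ * β y) := by
    intro y
    rw [Equiv.eq_symm_apply]
    ext i
    simp [β, σ]
  rw [h2, h2, inv_mul_cancel] at h1
  exact h1.symm

theorem Sylow.nonempty_pi_mulEquiv {r : ℕ} {p a : Fin r → ℕ} (hp : ∀ i, (p i).Prime)
    (hinj : Function.Injective p) {H : Type u} [Group H] [Finite H]
    (hcomm : ∀ x y : H, x * y = y * x) (hH : Nat.card H = ∏ i, p i ^ a i)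
    (S : ∀ i, Sylow (p i) H) : Nonempty ((∀ i, (S i : Subgroup H)) ≃* H) := by
  have hc : Pairwise fun i j => ∀ x y : H, x ∈ (S i : Subgroup H) → y ∈ (S j : Subgroup H) →
    Commute x y := fun i j _ x y _ _ => hcomm x y
  have hcard : ∀ i, Nat.card (S i : Subgroup H) = p i ^ a i := fun i =>
    Sylow.card_of_card_eq_prod hp hinj hH i (S i)
  refine ⟨MulEquiv.ofBijective (Subgroup.noncommPiCoprod hc)
    ((Nat.bijective_iff_injective_and_card _).2 ⟨?_, ?_⟩)⟩
  · have := fun i => Fintype.ofFinite (S i : Subgroup H)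
    refine Subgroup.injective_noncommPiCoprod_of_iSupIndep
      (Subgroup.independent_of_coprime_order hc fun i j hij => ?_)
    beta_reduce
    rw [← Nat.card_eq_fintype_card, ← Nat.card_eq_fintype_card, hcard, hcard]
    exact Nat.Coprime.pow _ _ ((Nat.coprime_primes (hp i) (hp j)).2 fun h => hij (hinj h))
  · rw [Nat.card_pi, hH]
    exact Finset.prod_congr rfl fun i _ => hcard i

theorem theorem3p6 {X : Type u} [Finite X] (r : ℕ) (p a : Fin r → ℕ)
    (hp : ∀ i, (p i).Prime) (hp_inj : Function.Injective p) (ha : ∀ i, 0 < a i)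
    (hn : Nat.card X = ∏ i, p i ^ a i)
    (G H : Subgroup (Equiv.Perm X))
    (hG_cyclic : IsCyclic G) (hG_regular : IsRegularPermGroup G)
    (hH_abelian : IsMulCommutative H) (hH_regular : IsRegularPermGroup H)
    (Gp : ∀ i, Sylow (p i) G) (Hp : ∀ i, Sylow (p i) H)
    (Γ : Digraph X) (hΓ : IsCayleyDigraphOf Γ G) :
    (∀ (V : Fin r → Type u) (Δ : ∀ i, Digraph (V i)),
      IsOfProductType Γ Δ →
      (∀ i, IsCayleyDigraphOf (Δ i) (Gp i : Subgroup G) ∧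
        IsCayleyDigraphOf (Δ i) (Hp i : Subgroup H)) →
      IsCayleyDigraphOf Γ H) ∧
    (∀ N : Subgroup (Equiv.Perm X), Group.IsNilpotent N → G ≤ N → H ≤ N → N ≤ digraphAut Γ →
      ∃ (V : Fin r → Type u) (Δ : ∀ i, Digraph (V i)),
        IsOfProductType Γ Δ ∧
        (∀ i, IsCayleyDigraphOf (Δ i) (Gp i : Subgroup G) ∧
          IsCayleyDigraphOf (Δ i) (Hp i : Subgroup H)) ∧
        ∀ i, IsMultiwreathOfCyclic (digraphAut (Δ i))) := by
  have hpf : ∀ i, Fact (p i).Prime := fun i => ⟨hp i⟩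
  have hX : Nonempty X := by
    refine (Nat.card_pos_iff.1 ?_).1
    rw [hn]
    exact Finset.prod_pos fun i _ => pow_pos (hp i).pos _
  have hHc : ∀ h ∈ H, ∀ k ∈ H, h * k = k * h := fun h hh k hk =>
    congrArg Subtype.val (hH_abelian.is_comm.comm (⟨h, hh⟩ : H) ⟨k, hk⟩)
  have hGcard := hG_regular.card_eq.trans hn
  have hHcard := hH_regular.card_eq.trans hn
  refine ⟨fun V Δ hprod hcay => ?_, fun N hN hGN hHN hNΓ => ?_⟩
  · obtain ⟨ε⟩ := Sylow.nonempty_pi_mulEquiv hp hp_inj hH_abelian.is_comm.comm hHcard Hp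
    exact (hprod.isCayleyDigraphOf_pi fun i => (hcay i).2).congr ε
  · obtain ⟨κ, T, hTG, hT⟩ := exists_translation_coordinates hp_inj hn hG_cyclic hG_regular
    choose Y Δ e hmw hZ hQ hcl using fun i => exists_coord_multiwreath hp_inj hn hN κ T
      (fun w => hGN (hTG w)) hT hHN hH_regular hHc i (Hp i : Subgroup H) (Hp i).isPGroup'
      (Sylow.card_of_card_eq_prod hp hp_inj hHcard i (Hp i))
    refine ⟨Y, Δ, ⟨(Equiv.piCongrRight e).symm.trans κ, fun σ hσ => ?_⟩,
      fun i => ⟨(hZ i).congr (mulEquivOfCyclicCardEq ?_), hQ i⟩, hmw⟩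
    -- Each automorphism of `Δ i` agrees on any two points with the action of an element of `N`,
    -- hence of `Aut Γ`.
    · have h1 := digraphAut_of_coord (Γ := Γ) κ (fun i => (e i).symm.permCongr (σ i))
        fun i x y => by
          obtain ⟨π, hπ, hx, hy⟩ := hcl i (σ i) (hσ i) x y
          exact ⟨π, hNΓ hπ, by simp [← hx], by simp [← hy]⟩
      exact h1
    · have h2 := Sylow.card_of_card_eq_prod hp hp_inj hGcard i (Gp i)
      rw [Nat.card_congr Multiplicative.toAdd, Nat.card_zmod]
      exact h2.symm
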